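/- Let $n\ge 0$. A composition is a sequence $\mu=(\mu_1,\dots,\mu_n)$ of non-negative integers, $|\mu|=\mu_1+\cdots+\mu_n$, and $N\mu=(N\mu_1,\dots,N\mu_n)$; a partition is a weakly decreasing composition (zeros at the end are allowed, so sequences of different lengths are brought to a common length $n$ by adding zeros). Put $\delta=(n-1,n-2,\dots,1,0)$. For a partition $\lambda$ and a composition $\mu$ with $|\lambda|=|\mu|$, the Kostka number $K_{\lambda,\mu}(1)$ is the value at $q=1$ of the Kostka–Foulkes polynomial $$K_{\lambda,\mu}(q)=\sum_{w\in\Sigma_n}(-1)^{\ell(w)}\,K_n\big(w(\lambda+\delta)-\mu-\delta\,\big|\,q\big),\qquad \sum_{\gamma}K_n(\gamma\,|\,q)\,x^{\gamma}=\prod_{1\le i<j\le n}\Big(1-q\,\frac{x_i}{x_j}\Big)^{-1},$$ where the product is expanded in powers of the $q\,x_i/x_j$, $i<j$. The Gelfand–Tsetlin polytope $GT(\lambda,\mu)$ is the set of real triangular arrays $(x_{k,i})_{1\le i\le k\le n}$ with $x_{n,i}=\lambda_i$, $x_{k+1,i}\ge x_{k,i}\ge x_{k+1,i+1}$ and $\sum_{i\le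 k}x_{k,i}=\mu_1+\cdots+\mu_k$ for all $k$; its Ehrhart function is $N\mapsto\#\big(N\cdot GT(\lambda,\mu)\cap\mathbb Z^{n(n+1)/2}\big)$. For partitions $\lambda,\mu,\nu$, the Littlewood–Richardson numbers $c_{\lambda,\mu}^{\nu}$ are the structure constants of the multiplication of Schur functions: $s_\lambda s_\mu=\sum_\nu c_{\lambda,\mu}^{\nu}s_\nu$, where $s_\lambda=\det(x_i^{\lambda_j+\delta_j})/\det(x_i^{\delta_j})$ in the variables $x_1,\dots,x_n$, and $\nu$ runs over the partitions with at most $n$ non-zero parts. (i) Let $\lambda$ be a partition and $\mu$ a composition with $|\lambda|=|\mu|$. Then there is a polynomial $\mathcal E_{\lambda,\mu}$ with rational coefficients such that for all integers $N\ge 1$ $$\mathcal E_{\lambda,\mu}(N)=K_{N\lambda,N\mu}(1)=\#\big(N\cdot GT(\lambda,\mu)\cap\mathbb Z^{n(n+1)/2}\big);$$ that is, $K_{N\lambda,N\mu}(1)$ is a polynomial in $N$ and, equivalently, so is the Ehrhart function of $GT(\lambda,\mu)$. (ii) Let $\lambda,\mu,\nu$ be partitions. Then there is a polynomial $P$ with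 rational coefficients such that $c_{N\lambda,N\mu}^{N\nu}=P(N)$ for all integers $N\ge 1$. -/

import Mathlib

open scoped Pointwise

/-! ### Partitions and compositions

Compositions are sequences `Fin n → ℕ` (zeros allowed); a partition is a weakly decreasing one,
so that a partition may end in a string of zeros. -/

/-- Partitions `lam 0 ≥ lam 1 ≥ ⋯ ≥ lam (n - 1) ≥ 0`, written as sequences of length `n`. -/
abbrev PartitionSeq (n : ℕ) : Type := {lam : Fin n → ℕ // Antitone lam}

/-- The partition `N lam = (N lam 0, …, N lam (n - 1))`. -/
def PartitionSeq.dilate {n : ℕ} (N : ℕ) (lam : PartitionSeq n) : PartitionSeq n :=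
  ⟨fun i => N * lam.1 i, fun _ _ h => Nat.mul_le_mul_left N (lam.2 h)⟩

/-- `δ = (n - 1, n - 2, …, 1, 0)`. -/
def staircase (n : ℕ) : Fin n → ℕ := fun i => (i.rev : ℕ)

/-! ### Kostka–Foulkes polynomials -/

/-- The pairs `i < j`, i.e. the positive roots `e i - e j` of type `A`. -/
abbrev RootPair (n : ℕ) : Type := {p : Fin n × Fin n // p.1 < p.2}

/-- The ways to write `γ` as a sum of positive roots `e i - e j`, `i < j`, where the root
`e i - e j` is used `m (i, j)` times. -/
def kostantPartitions {n : ℕ} (γ : Fin n → ℤ) : Set (RootPair n → ℕ) :=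
  {m | ∑ p : RootPair n, (m p : ℤ) • (Pi.single p.1.1 1 - Pi.single p.1.2 1 : Fin n → ℤ) = γ}

theorem kostantPartitions_finite {n : ℕ} (γ : Fin n → ℤ) : (kostantPartitions γ).Finite := by
  refine (Set.finite_Iic (fun _ : RootPair n => (-∑ i : Fin n, (i : ℤ) * γ i).toNat)).subset ?_
  intro m hm p
  have key : -∑ i : Fin n, (i : ℤ) * γ i
      = ∑ p : RootPair n, (m p : ℤ) * (((p.1.2 : ℕ) : ℤ) - ((p.1.1 : ℕ) : ℤ)) := by
    rw [← (show _ = γ from hm)]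
    simp only [Finset.sum_apply, Pi.smul_apply, Pi.sub_apply, smul_eq_mul, Finset.mul_sum]
    rw [Finset.sum_comm, ← Finset.sum_neg_distrib]
    refine Finset.sum_congr rfl fun p _ => ?_
    have h : ∀ a : Fin n, ∑ i : Fin n, (i : ℤ) * (Pi.single a (1 : ℤ) : Fin n → ℤ) i
        = ((a : ℕ) : ℤ) := by
      intro a
      simp [Pi.single_apply]
    have h2 : ∀ i : Fin n, (i : ℤ) * ((m p : ℤ) * ((Pi.single p.1.1 (1 : ℤ) : Fin n → ℤ) i
        - (Pi.single p.1.2 (1 : ℤ) : Fin n → ℤ) i))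
        = (m p : ℤ) * ((i : ℤ) * (Pi.single p.1.1 (1 : ℤ) : Fin n → ℤ) i)
          - (m p : ℤ) * ((i : ℤ) * (Pi.single p.1.2 (1 : ℤ) : Fin n → ℤ) i) := by
      intro i; ring
    simp only [h2, Finset.sum_sub_distrib, ← Finset.mul_sum, h]
    ring
  have hterm : ∀ r : RootPair n, (m r : ℤ)
      ≤ (m r : ℤ) * (((r.1.2 : ℕ) : ℤ) - ((r.1.1 : ℕ) : ℤ)) := by
    intro r
    have : ((r.1.1 : ℕ) : ℤ) < ((r.1.2 : ℕ) : ℤ) := by exact_mod_cast r.2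
    nlinarith [Int.natCast_nonneg (m r)]
  have hle : (m p : ℤ) ≤ -∑ i : Fin n, (i : ℤ) * γ i := by
    rw [key]
    refine (hterm p).trans (Finset.single_le_sum
      (f := fun r : RootPair n => (m r : ℤ) * (((r.1.2 : ℕ) : ℤ) - ((r.1.1 : ℕ) : ℤ)))
      (fun r _ => ?_) (Finset.mem_univ p))
    exact (Int.natCast_nonneg _).trans (hterm r)
  have h : m p ≤ (-∑ i : Fin n, (i : ℤ) * γ i).toNat := by omega
  exact h

/-- The `q`-analogue of Kostant's partition function: the coefficient of `x ^ γ` in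
`∏_{i < j} (1 - q x_i / x_j)⁻¹`, i.e. the sum of `q ^ (number of roots used)` over all ways to
write `γ` as a sum of positive roots. The variable `q` is `Polynomial.X`. -/
noncomputable def qKostant {n : ℕ} (γ : Fin n → ℤ) : Polynomial ℤ :=
  ∑ m ∈ (kostantPartitions_finite γ).toFinset, Polynomial.X ^ (∑ p : RootPair n, m p)

/-- The Kostka–Foulkes polynomial
`K_{lam, mu}(q) = ∑_w (-1) ^ l(w) K_n(w (lam + δ) - mu - δ | q)` of a partition `lam` and a
composition `mu`. -/
noncomputable def kostkaFoulkes {n : ℕ} (lam : PartitionSeq n) (mu : Fin n → ℕ) : Polynomial ℤ :=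
  ∑ w : Equiv.Perm (Fin n), ((Equiv.Perm.sign w : ℤˣ) : ℤ) •
    qKostant (fun i => ((lam.1 (w i) + staircase n (w i) : ℕ) : ℤ)
      - ((mu i + staircase n i : ℕ) : ℤ))

/-- The Kostka number `K_{lam, mu}(1)`. -/
noncomputable def kostkaNumber {n : ℕ} (lam : PartitionSeq n) (mu : Fin n → ℕ) : ℤ :=
  (kostkaFoulkes lam mu).eval 1

/-! ### The Gelfand–Tsetlin polytope -/

/-- Positions `(k, i)`, `i ≤ k`, of a triangular array whose row `k` has `k + 1` entries. -/
abbrev GTIndex (n : ℕ) : Type := {p : Fin n × Fin n // p.2 ≤ p.1}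

/-- The Gelfand–Tsetlin polytope `GT(lam, mu)`: real triangular arrays `x` whose last (longest) row
is `lam`, whose consecutive rows interlace, `x (k + 1, i) ≥ x (k, i) ≥ x (k + 1, i + 1)`, and whose
row `k` has the sum `mu 0 + ⋯ + mu k`. -/
def gtPolytope {n : ℕ} (lam : PartitionSeq n) (mu : Fin n → ℕ) : Set (GTIndex n → ℝ) :=
  {x | (∀ s : GTIndex n, (s.1.1 : ℕ) + 1 = n → x s = (lam.1 s.1.2 : ℝ)) ∧
    (∀ s t : GTIndex n, (t.1.1 : ℕ) = s.1.1 + 1 →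
      ((t.1.2 : ℕ) = s.1.2 → x s ≤ x t) ∧ ((t.1.2 : ℕ) = s.1.2 + 1 → x t ≤ x s)) ∧
    (∀ k : Fin n, ∑ s : GTIndex n with s.1.1 = k, x s = ∑ j : Fin n with j ≤ k, (mu j : ℝ))}

/-- The Ehrhart function `N ↦ #(N A ∩ ℤ ^ ι)` of a bounded set `A ⊆ ℝ ^ ι`. -/
noncomputable def ehrhartFunction {ι : Type} (A : Set (ι → ℝ)) (N : ℕ) : ℕ :=
  (((N : ℝ) • A) ∩ {x | ∀ t, ∃ z : ℤ, x t = (z : ℝ)}).ncard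

/-! ### Schur functions and Littlewood–Richardson numbers -/

/-- The alternant `a_α(x_0, …, x_{n-1}) = det (x_i ^ α_j)`. -/
noncomputable def alternant {n : ℕ} (α : Fin n → ℕ) : MvPolynomial (Fin n) ℤ :=
  (Matrix.of fun i j => (MvPolynomial.X i : MvPolynomial (Fin n) ℤ) ^ α j).det

theorem alternant_staircase_dvd {n : ℕ} (α : Fin n → ℕ) :
    alternant (staircase n) ∣ alternant α := by
  classical
  let S := MvPolynomial (Fin n) ℤ
  let Q : Polynomial S := ∏ i : Fin n, (Polynomial.X - Polynomial.C (MvPolynomial.X i))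
  have hQ : Q.Monic := Polynomial.monic_prod_of_monic _ _ fun i _ => Polynomial.monic_X_sub_C _
  have hdeg : Q.natDegree = n := by
    simp only [Q]
    rw [Polynomial.natDegree_prod_of_monic _ _ fun i _ => Polynomial.monic_X_sub_C _]
    simp
  let R : Matrix (Fin n) (Fin n) S :=
    Matrix.of fun k j => ((Polynomial.X ^ α j : Polynomial S) %ₘ Q).coeff (k.rev : ℕ)
  refine ⟨R.det, ?_⟩
  unfold alternant
  rw [← Matrix.det_mul]
  congr 1
  ext1 i j
  have hn : n ≠ 0 := fun h => (h ▸ i).elim0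
  have hQi : Q.eval (MvPolynomial.X i) = 0 := by
    simp only [Q, Polynomial.eval_prod]
    exact Finset.prod_eq_zero (Finset.mem_univ i) (by simp)
  have hlt : ((Polynomial.X ^ α j : Polynomial S) %ₘ Q).natDegree < n := by
    have := Polynomial.natDegree_modByMonic_lt (Polynomial.X ^ α j : Polynomial S) hQ
      (fun h => hn (by rw [← hdeg, h]; simp))
    rwa [hdeg] at this
  have h1 : (MvPolynomial.X i : S) ^ α j
      = ((Polynomial.X ^ α j : Polynomial S) %ₘ Q).eval (MvPolynomial.X i) := by
    have h := congrArg (Polynomial.eval (MvPolynomial.X i : S))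
      (Polynomial.modByMonic_add_div (Polynomial.X ^ α j : Polynomial S) Q)
    rw [Polynomial.eval_add, Polynomial.eval_mul, hQi, zero_mul, add_zero, Polynomial.eval_pow,
      Polynomial.eval_X] at h
    exact h.symm
  rw [Matrix.mul_apply]
  simp only [Matrix.of_apply, R, staircase]
  rw [h1, Polynomial.eval_eq_sum_range' hlt, ← Fin.sum_univ_eq_sum_range
    (fun k => ((Polynomial.X ^ α j : Polynomial S) %ₘ Q).coeff k * (MvPolynomial.X i : S) ^ k)]
  rw [← Equiv.sum_comp Fin.revPerm]
  refine Finset.sum_congr rfl fun k _ => ?_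
  simp [mul_comm]

/-- The Schur function `s_lam(x_0, …, x_{n-1}) = a_{lam + δ} / a_δ`, as a polynomial. -/
noncomputable def schur {n : ℕ} (lam : PartitionSeq n) : MvPolynomial (Fin n) ℤ :=
  Classical.choose (alternant_staircase_dvd (lam.1 + staircase n))

theorem alternant_mul_schur {n : ℕ} (lam : PartitionSeq n) :
    alternant (staircase n) * schur lam = alternant (lam.1 + staircase n) :=
  (Classical.choose_spec (alternant_staircase_dvd (lam.1 + staircase n))).symm

theorem strictAnti_add_staircase {n : ℕ} (lam : PartitionSeq n) :
    StrictAnti (lam.1 + staircase n) := fun i j h => by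
  have h1 := lam.2 h.le
  have h2 : ((j.rev : Fin n) : ℕ) < (i.rev : ℕ) := Fin.rev_lt_rev.2 h
  simp only [Pi.add_apply, staircase]
  omega

theorem alternant_eq_sum {n : ℕ} (α : Fin n → ℕ) :
    alternant α = ∑ σ : Equiv.Perm (Fin n), ((Equiv.Perm.sign σ : ℤˣ) : ℤ) •
      MvPolynomial.monomial (Finsupp.equivFunOnFinite.symm (α ∘ σ)) (1 : ℤ) := by
  unfold alternant
  rw [Matrix.det_apply, ← Equiv.sum_comp (Equiv.inv _)]
  refine Finset.sum_congr rfl fun σ _ => ?_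
  simp only [Equiv.inv_apply, Equiv.Perm.sign_inv, Matrix.of_apply]
  rw [Units.smul_def]
  congr 1
  rw [← Equiv.prod_comp σ, MvPolynomial.monomial_eq, Finsupp.prod_fintype _ _ (by simp)]
  simp

theorem rename_alternant {n : ℕ} (α : Fin n → ℕ) (τ : Equiv.Perm (Fin n)) :
    MvPolynomial.rename τ (alternant α) = ((Equiv.Perm.sign τ : ℤˣ) : ℤ) • alternant α := by
  unfold alternant
  rw [AlgHom.map_det, ← Units.smul_def, Units.smul_def, zsmul_eq_mul, ← Matrix.det_permute]
  congr 1
  ext1 i j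
  simp

theorem coeff_alternant {n : ℕ} {α β : Fin n → ℕ} (hα : StrictAnti α) (hβ : StrictAnti β) :
    (alternant α).coeff (Finsupp.equivFunOnFinite.symm β) = if α = β then 1 else 0 := by
  classical
  rw [alternant_eq_sum, MvPolynomial.coeff_sum]
  simp only [MvPolynomial.coeff_smul, MvPolynomial.coeff_monomial, EmbeddingLike.apply_eq_iff_eq]
  rw [Finset.sum_eq_single 1]
  · simp
  · intro σ _ hσ
    rw [if_neg, smul_zero]
    intro h
    apply hσ
    have hmono : StrictMono σ := fun i j hij => by
      have : (α ∘ σ) j < (α ∘ σ) i := by rw [h]; exact hβ hij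
      exact hα.lt_iff_gt.1 this
    have := (Equiv.Perm.monotone_iff σ).1 hmono.monotone
    exact this
  · simp

/-- An alternating polynomial is determined by its coefficients at the exponents `nu + δ`. -/
theorem alternating_eq_zero {n : ℕ} {f : MvPolynomial (Fin n) ℤ}
    (hf : ∀ τ : Equiv.Perm (Fin n),
      MvPolynomial.rename τ f = ((Equiv.Perm.sign τ : ℤˣ) : ℤ) • f)
    (h0 : ∀ nu : PartitionSeq n,
      f.coeff (Finsupp.equivFunOnFinite.symm (nu.1 + staircase n)) = 0) : f = 0 := by
  classical
  have hc : ∀ (τ : Equiv.Perm (Fin n)) (d : Fin n →₀ ℕ),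
      f.coeff d = ((Equiv.Perm.sign τ : ℤˣ) : ℤ) * f.coeff (d.mapDomain τ) := by
    intro τ d
    have h := congrArg (MvPolynomial.coeff (d.mapDomain τ)) (hf τ)
    rw [MvPolynomial.coeff_rename_mapDomain _ τ.injective, MvPolynomial.coeff_smul] at h
    simpa using h
  have hmap : ∀ (τ : Equiv.Perm (Fin n)) (d : Fin n →₀ ℕ) (i : Fin n),
      d.mapDomain τ i = d (τ.symm i) := fun τ d i => by
    rw [← Finsupp.equivMapDomain_eq_mapDomain, Finsupp.equivMapDomain_apply]
  ext d
  rw [MvPolynomial.coeff_zero]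
  by_cases hinj : Function.Injective d
  · let τ : Equiv.Perm (Fin n) := (Fin.revPerm.trans (Tuple.sort d)).symm
    have hanti : StrictAnti (d.mapDomain τ) := by
      have : StrictMono (d ∘ Tuple.sort d) :=
        (Tuple.monotone_sort d).strictMono_of_injective (hinj.comp (Tuple.sort d).injective)
      intro i j hij
      rw [hmap, hmap]
      exact this (Fin.rev_lt_rev.2 hij)
    have hge : ∀ i j : Fin n, i ≤ j →
        d.mapDomain τ j + (j : ℕ) ≤ d.mapDomain τ i + (i : ℕ) := by
      intro i j hij
      obtain ⟨j, hj⟩ := j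
      obtain ⟨i, hi⟩ := i
      have hij' : i ≤ j := hij
      clear hij
      induction j, hij' using Nat.le_induction with
      | base => exact le_refl _
      | succ k hk ih =>
        have h1 := ih (by omega)
        have h2 : d.mapDomain τ ⟨k + 1, hj⟩ < d.mapDomain τ ⟨k, by omega⟩ :=
          hanti (Fin.mk_lt_mk.2 (Nat.lt_succ_self k))
        simp only at h1 ⊢
        omega
    have hst : ∀ i : Fin n, staircase n i ≤ d.mapDomain τ i := by
      intro i
      have := hge i ⟨n - 1, by have := i.2; omega⟩ (Fin.mk_le_mk.2 (by have := i.2; omega))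
      simp only [staircase, Fin.val_rev] at this ⊢
      omega
    have hnu : Antitone fun i => d.mapDomain τ i - staircase n i := by
      intro i j hij
      have h1 := hge i j hij
      have h2 := hst i
      have h3 := hst j
      have h4 : (i : ℕ) ≤ (j : ℕ) := hij
      have h5 := j.2
      simp only [staircase, Fin.val_rev] at h2 h3 ⊢
      omega
    have h := h0 ⟨_, hnu⟩
    have he : Finsupp.equivFunOnFinite.symm
        ((fun i => d.mapDomain τ i - staircase n i) + staircase n) = d.mapDomain τ := by
      ext i
      exact Nat.sub_add_cancel (hst i)
    rw [hc τ d]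
    rw [show Finsupp.equivFunOnFinite.symm
        ((⟨_, hnu⟩ : PartitionSeq n).1 + staircase n) = d.mapDomain τ from he] at h
    rw [h, mul_zero]
  · obtain ⟨i, j, hij, hne⟩ : ∃ i j, d i = d j ∧ i ≠ j := by
      simpa [Function.Injective] using hinj
    have hd : d.mapDomain (Equiv.swap i j) = d := by
      ext k
      rw [hmap, Equiv.symm_swap, Equiv.swap_apply_def]
      split_ifs with h1 h2
      · rw [h1, hij]
      · rw [h2, hij]
      · rfl
    have h := hc (Equiv.swap i j) d
    rw [hd, Equiv.Perm.sign_swap hne] at h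
    simp at h
    omega

theorem alternant_staircase_ne_zero (n : ℕ) : alternant (staircase n) ≠ 0 := by
  intro h
  have hs : StrictAnti (staircase n) := fun i j hij => Fin.rev_lt_rev.2 hij
  have h1 := coeff_alternant hs hs
  rw [h] at h1
  simp at h1

theorem rename_schur {n : ℕ} (lam : PartitionSeq n) (τ : Equiv.Perm (Fin n)) :
    MvPolynomial.rename τ (schur lam) = schur lam := by
  have h := congrArg (MvPolynomial.rename τ) (alternant_mul_schur lam)
  rw [map_mul, rename_alternant, rename_alternant, ← alternant_mul_schur, smul_mul_assoc] at h
  have hu : IsUnit (((Equiv.Perm.sign τ : ℤˣ) : ℤ)) := (Equiv.Perm.sign τ).isUnit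
  have h2 := hu.smul_left_cancel.1 h
  exact mul_left_cancel₀ (alternant_staircase_ne_zero n) h2

/-- The Schur functions of the partitions with at most `n` parts have well defined structure
constants: `s_lam s_mu` is in exactly one way an integral linear combination of Schur functions. -/
theorem existsUnique_schur_mul {n : ℕ} (lam mu : PartitionSeq n) :
    ∃! c : PartitionSeq n →₀ ℤ, schur lam * schur mu = c.sum fun nu z => z • schur nu := by
  classical
  have hcoef : ∀ (c : PartitionSeq n →₀ ℤ) (nu : PartitionSeq n),
      (c.sum fun nu z => z • alternant (nu.1 + staircase n)).coeff
        (Finsupp.equivFunOnFinite.symm (nu.1 + staircase n)) = c nu := by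
    intro c nu
    rw [Finsupp.sum, MvPolynomial.coeff_sum]
    simp only [MvPolynomial.coeff_smul]
    have : ∀ k : PartitionSeq n, (alternant (k.1 + staircase n)).coeff
        (Finsupp.equivFunOnFinite.symm (nu.1 + staircase n)) = if k = nu then 1 else 0 := by
      intro k
      rw [coeff_alternant (strictAnti_add_staircase k) (strictAnti_add_staircase nu)]
      congr 1
      rw [add_left_inj]
      exact propext Subtype.ext_iff.symm
    simp only [this, smul_eq_mul, mul_ite, mul_one, mul_zero, Finset.sum_ite_eq']
    split_ifs with h
    · rfl
    · exact (Finsupp.notMem_support_iff.1 h).symm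
  have hmul : ∀ c : PartitionSeq n →₀ ℤ,
      alternant (staircase n) * (c.sum fun nu z => z • schur nu)
        = c.sum fun nu z => z • alternant (nu.1 + staircase n) := by
    intro c
    simp only [Finsupp.sum, Finset.mul_sum, mul_smul_comm, alternant_mul_schur]
  have hiff : ∀ c : PartitionSeq n →₀ ℤ,
      (schur lam * schur mu = c.sum fun nu z => z • schur nu) ↔
      alternant (staircase n) * (schur lam * schur mu)
        = c.sum fun nu z => z • alternant (nu.1 + staircase n) := by
    intro c
    rw [← hmul]
    exact (mul_right_inj' (alternant_staircase_ne_zero n)).symm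
  set f := alternant (staircase n) * (schur lam * schur mu) with hf
  have hinj : Function.Injective fun nu : PartitionSeq n =>
      (Finsupp.equivFunOnFinite.symm (nu.1 + staircase n) : Fin n →₀ ℕ) := by
    intro a b hab
    exact Subtype.ext (add_right_cancel (Finsupp.equivFunOnFinite.symm.injective hab))
  refine ⟨∑ nu ∈ f.support.preimage _ hinj.injOn,
    Finsupp.single nu (f.coeff (Finsupp.equivFunOnFinite.symm (nu.1 + staircase n))), ?_, ?_⟩
  · refine (hiff _).2 ?_
    rw [← sub_eq_zero]
    apply alternating_eq_zero
    · intro τ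
      rw [map_sub, hf, map_mul, map_mul, rename_schur, rename_schur, rename_alternant, smul_sub,
        Finsupp.sum, map_sum, Finset.smul_sum, smul_mul_assoc]
      congr 1
      refine Finset.sum_congr rfl fun k _ => ?_
      rw [map_zsmul, rename_alternant, smul_comm]
    · intro nu
      rw [MvPolynomial.coeff_sub, hcoef, sub_eq_zero, Finsupp.finsetSum_apply]
      simp only [Finsupp.single_apply]
      rw [Finset.sum_ite_eq']
      split_ifs with h
      · rfl
      · simpa using h
  · intro c hc
    have hc' := (hiff c).1 hc
    ext nu
    rw [← hcoef c nu, ← hc', Finsupp.finsetSum_apply]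
    simp only [Finsupp.single_apply]
    rw [Finset.sum_ite_eq']
    split_ifs with h
    · rfl
    · simpa using h

/-- The Littlewood–Richardson number `c_{lam, mu}^nu`, the structure constant in
`s_lam s_mu = ∑_nu c_{lam, mu}^nu s_nu`. -/
noncomputable def lrNumber {n : ℕ} (lam mu nu : PartitionSeq n) : ℤ :=
  Classical.choose (existsUnique_schur_mul lam mu).exists nu

/-! The Kostka and Littlewood–Richardson numbers along a dilation each have two descriptions, one
controlling large `N` and one controlling every `N ≥ 1`.

Signed description: at `q = 1` the Kostka–Foulkes formula, and for products Steinberg's formula, are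
signed sums of values of Kostant's partition function at points `N b + c`. Along such a ray the
partition function is polynomial for large `N` (`evPoly_vecCount_rootVec`). There is no periodicity,
because every lattice spanned by roots of type A is saturated. The shifts by `δ` prevent this
argument from reaching small `N`.

Positive description: both numbers count the integer solutions of a bounded homogeneous linear
system in `(x, N)`. Elliott's elimination (`vecCount_elliott`, `backRec_vecCount`) shows that such a
count satisfies, from `N = 1` on, a linear recurrence with non-zero lowest coefficient. If `P` is
the eventual polynomial, then `f - P` satisfies such a recurrence and vanishes for large `N`;
running the recurrence backwards gives `f = P` on all `N ≥ 1`
(`exists_polynomial_of_backRec_of_evPoly`).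

The positive formulas come from a cancellation on Gelfand–Tsetlin patterns in the style of
Stembridge. By the Bender–Knuth symmetry, `a_{mu + δ}` times the generating function of the patterns
is the sum of `a_{mu + weight + δ}` over patterns. Toggling the columns to the left of the first
violation of dominance cancels all bad patterns in pairs (`alternant_mul_gtSum_eq_sum_good`). For
`mu = 0` a single pattern survives, so the generating function is the Schur function
(`schur_eq_gtSum`); for general `mu` the result is the Littlewood–Richardson rule
(`lrNumber_eq_ncard`). Goodness is then rewritten as finitely many linear inequalities
(`IsGT.isGood_iff`), and the lattice points of the polytope are identified with patterns
(`image_gtPoint`). -/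

/-! ### Backward recursive and eventually polynomial sequences -/

/-- The shift operator `(f 0, f 1, …) ↦ (f 1, f 2, …)` on rational sequences. -/
noncomputable def seqShift : Module.End ℚ (ℕ → ℚ) := LinearMap.funLeft ℚ ℚ Nat.succ

theorem seqShift_pow_apply (d : ℕ) (f : ℕ → ℚ) (N : ℕ) : (seqShift ^ d) f N = f (N + d) := by
  induction d generalizing N with
  | zero => simp
  | succ d ih =>
    rw [pow_succ', Module.End.mul_apply]
    change (seqShift ^ d) f (N + 1) = _
    rw [ih]
    congr 1
    omega

/-- The sequence `f 1, f 2, …` satisfies a linear recurrence that can be run backwards. -/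
def BackRec (f : ℕ → ℚ) : Prop :=
  ∃ Q : Polynomial ℚ, Q.coeff 0 ≠ 0 ∧ Polynomial.aeval seqShift Q (seqShift f) = 0

theorem BackRec.of_eq_zero {f : ℕ → ℚ} (h : ∀ N, 1 ≤ N → f N = 0) : BackRec f := by
  refine ⟨1, by simp, ?_⟩
  have : seqShift f = 0 := by
    funext N
    exact h (N + 1) (by omega)
  rw [this, map_zero]

theorem BackRec.congr {f g : ℕ → ℚ} (hf : BackRec f) (h : ∀ N, 1 ≤ N → g N = f N) :
    BackRec g := by
  have : seqShift g = seqShift f := by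
    funext N
    exact h (N + 1) (by omega)
  rw [BackRec, this]
  exact hf

/-- The product of two annihilating polynomials annihilates both sequences, and its constant term is
again non-zero. -/
theorem BackRec.add {f g : ℕ → ℚ} (hf : BackRec f) (hg : BackRec g) : BackRec (f + g) := by
  obtain ⟨P, hP0, hP⟩ := hf
  obtain ⟨Q, hQ0, hQ⟩ := hg
  refine ⟨P * Q, by rw [Polynomial.mul_coeff_zero]; exact mul_ne_zero hP0 hQ0, ?_⟩
  rw [map_add, map_add]
  nth_rewrite 1 [mul_comm P Q]
  rw [map_mul, map_mul, Module.End.mul_apply, Module.End.mul_apply, hP, hQ]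
  simp

theorem BackRec.neg {f : ℕ → ℚ} (hf : BackRec f) : BackRec (-f) := by
  obtain ⟨P, hP0, hP⟩ := hf
  exact ⟨P, hP0, by rw [map_neg, map_neg, hP, neg_zero]⟩

theorem BackRec.sub {f g : ℕ → ℚ} (hf : BackRec f) (hg : BackRec g) : BackRec (f - g) := by
  rw [sub_eq_add_neg]
  exact hf.add hg.neg

theorem BackRec.shift {f : ℕ → ℚ} (hf : BackRec f) (d : ℕ) :
    BackRec (fun N => f (N + d)) := by
  obtain ⟨P, hP0, hP⟩ := hf
  refine ⟨P, hP0, ?_⟩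
  have h : (fun N => f (N + d)) = (seqShift ^ d) f := by
    funext N
    rw [seqShift_pow_apply]
  have hc : Polynomial.aeval seqShift (P * Polynomial.X * Polynomial.X ^ d) f
      = Polynomial.aeval seqShift (Polynomial.X ^ d * (P * Polynomial.X)) f := by
    rw [mul_comm]
  simp only [map_mul, map_pow, Polynomial.aeval_X, Module.End.mul_apply, hP, map_zero] at hc
  rw [h]
  exact hc

/-- The extra factor `X ^ d - 1` has constant term `-1` since `d ≥ 1`, so the recurrence stays
reversible. -/
theorem BackRec.of_difference {f : ℕ → ℚ} {d : ℕ} (hd : 1 ≤ d)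
    (hf : BackRec (fun N => f (N + d) - f N)) : BackRec f := by
  obtain ⟨P, hP0, hP⟩ := hf
  refine ⟨P * (Polynomial.X ^ d - 1), ?_, ?_⟩
  · rw [Polynomial.mul_coeff_zero]
    refine mul_ne_zero hP0 ?_
    have : (0 : ℕ) ≠ d := by omega
    simp [Polynomial.coeff_X_pow, Polynomial.coeff_one, this]
  · have h : (fun N => f (N + d) - f N) = (seqShift ^ d - 1) f := by
      funext N
      simp [seqShift_pow_apply]
    rw [h] at hP
    have hc : Polynomial.aeval seqShift (P * (Polynomial.X ^ d - 1) * Polynomial.X) f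
      = Polynomial.aeval seqShift (P * (Polynomial.X * (Polynomial.X ^ d - 1))) f := by
      congr 1; ring_nf
    rw [map_mul, map_mul, map_mul, map_mul, map_sub, map_pow, Polynomial.aeval_X, map_one] at hc
    rw [map_mul, map_sub, map_pow, Polynomial.aeval_X, map_one]
    exact hc.trans hP

/-- First differences lower the degree, so repeated differencing reaches zero. -/
theorem BackRec.of_polynomial (P : Polynomial ℚ) : BackRec (fun N => P.eval (N : ℚ)) := by
  induction hn : P.natDegree using Nat.strong_induction_on generalizing P with
  | _ n ih =>
    by_cases h0 : P.natDegree = 0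
    · refine BackRec.of_difference le_rfl (BackRec.of_eq_zero fun N _ => ?_)
      rw [Polynomial.eq_C_of_natDegree_eq_zero h0]
      simp
    · refine BackRec.of_difference le_rfl ((ih (P.comp (Polynomial.X + 1) - P).natDegree ?_ _
        rfl).congr fun N _ => by simp)
      have hX : (Polynomial.X + 1 : Polynomial ℚ) = Polynomial.X + Polynomial.C 1 := by simp
      have hdeg : (P.comp (Polynomial.X + 1)).natDegree = P.natDegree := by
        rw [Polynomial.natDegree_comp, hX, Polynomial.natDegree_X_add_C, mul_one]
      have hP : P ≠ 0 := fun h => h0 (by simp [h])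
      have hX1 : (Polynomial.X + 1 : Polynomial ℚ).natDegree = 1 := by
        rw [hX, Polynomial.natDegree_X_add_C]
      have hlc : (P.comp (Polynomial.X + 1)).leadingCoeff = P.leadingCoeff := by
        rw [Polynomial.leadingCoeff_comp (by rw [hX1]; exact one_ne_zero), hX,
          Polynomial.leadingCoeff_X_add_C, one_pow, mul_one]
      have hc : P.comp (Polynomial.X + 1) ≠ 0 := fun h => h0 (by rw [← hdeg, h]; simp)
      rw [← hn]
      by_cases hz : P.comp (Polynomial.X + 1) - P = 0
      · rw [hz, Polynomial.natDegree_zero]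
        omega
      · refine Polynomial.natDegree_lt_natDegree hz (Polynomial.degree_sub_lt_right ?_ hP hlc)
        rw [Polynomial.degree_eq_natDegree hc, Polynomial.degree_eq_natDegree hP, hdeg]

/-- Since the lowest coefficient is non-zero, each term is determined by later ones; zeros therefore
propagate down to index 1. -/
theorem BackRec.eq_zero {f : ℕ → ℚ} (hf : BackRec f) {N₀ : ℕ} (h : ∀ N, N₀ ≤ N → f N = 0) :
    ∀ N, 1 ≤ N → f N = 0 := by
  obtain ⟨Q, hQ0, hQ⟩ := hf
  -- Here `m` bounds the distance still to be covered below `N₀`.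
  have key : ∀ m N, 1 ≤ N → N₀ ≤ N + m → f N = 0 := by
    intro m
    induction m with
    | zero => intro N _ hN; exact h N hN
    | succ m ih =>
      intro N hN hNm
      have h1 := congrFun hQ (N - 1)
      rw [Polynomial.aeval_eq_sum_range, LinearMap.sum_apply, Finset.sum_apply,
        Finset.sum_eq_single 0] at h1
      · have h2 : seqShift f (N - 1) = f N := by
          change f (N - 1 + 1) = f N
          rw [Nat.sub_add_cancel hN]
        simp only [pow_zero, LinearMap.smul_apply, Module.End.one_apply, Pi.smul_apply,
          smul_eq_mul, Pi.zero_apply, h2] at h1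
        exact (mul_eq_zero.1 h1).resolve_left hQ0
      · intro i _ hi
        have h2 : (seqShift ^ i) (seqShift f) (N - 1) = f (N + i) := by
          rw [seqShift_pow_apply]
          change f (N - 1 + i + 1) = f (N + i)
          congr 1
          omega
        simp [h2, ih (N + i) (by omega) (by omega)]
      · simp
  intro N hN
  exact key N₀ N hN (by omega)

/-! ### Eventually polynomial sequences -/

/-- The sequence `f` agrees with a polynomial from some point on. -/
def EvPoly (f : ℕ → ℚ) : Prop :=
  ∃ P : Polynomial ℚ, ∃ N₀ : ℕ, ∀ N, N₀ ≤ N → f N = P.eval (N : ℚ)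

theorem EvPoly.add {f g : ℕ → ℚ} (hf : EvPoly f) (hg : EvPoly g) :
    EvPoly (fun N => f N + g N) := by
  obtain ⟨P, N₁, hP⟩ := hf
  obtain ⟨Q, N₂, hQ⟩ := hg
  refine ⟨P + Q, max N₁ N₂, fun N hN => ?_⟩
  change f N + g N = _
  rw [hP N (le_of_max_le_left hN), hQ N (le_of_max_le_right hN), Polynomial.eval_add]

theorem EvPoly.const_mul {f : ℕ → ℚ} (hf : EvPoly f) (a : ℚ) : EvPoly (fun N => a * f N) := by
  obtain ⟨P, N₁, hP⟩ := hf
  exact ⟨Polynomial.C a * P, N₁, fun N hN => by simp [hP N hN]⟩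

theorem EvPoly.sum {κ : Type*} (s : Finset κ) {f : κ → ℕ → ℚ} (h : ∀ i ∈ s, EvPoly (f i)) :
    EvPoly (fun N => ∑ i ∈ s, f i N) := by
  classical
  induction s using Finset.induction_on with
  | empty => exact ⟨0, 0, by simp⟩
  | insert a s ha ih =>
    simp only [Finset.sum_insert ha]
    exact (h a (Finset.mem_insert_self a s)).add
      (ih fun i hi => h i (Finset.mem_insert_of_mem hi))

/-- Bernoulli polynomials satisfy `B_{k+1}(x + 1) - B_{k+1}(x) = (k + 1) x ^ k`. -/
theorem exists_antidifference (P : Polynomial ℚ) :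
    ∃ Q : Polynomial ℚ, ∀ x : ℚ, Q.eval (x + 1) - Q.eval x = P.eval x := by
  induction P using Polynomial.induction_on' with
  | add p q hp hq =>
    obtain ⟨A, hA⟩ := hp
    obtain ⟨B, hB⟩ := hq
    refine ⟨A + B, fun x => ?_⟩
    simp only [Polynomial.eval_add, ← hA, ← hB]
    ring
  | monomial k a =>
    refine ⟨Polynomial.C (a / (k + 1)) * Polynomial.bernoulli (k + 1), fun x => ?_⟩
    have h := Polynomial.bernoulli_eval_one_add (k + 1) x
    rw [add_comm x 1]
    simp only [Polynomial.eval_mul, Polynomial.eval_C, h, Polynomial.eval_monomial]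
    have : (k : ℚ) + 1 ≠ 0 := by positivity
    push_cast
    field_simp
    simp
    ring

theorem EvPoly.of_difference {f : ℕ → ℚ} (hf : EvPoly (fun N => f (N + 1) - f N)) :
    EvPoly f := by
  obtain ⟨P, N₀, hP⟩ := hf
  obtain ⟨Q, hQ⟩ := exists_antidifference P
  refine ⟨Q + Polynomial.C (f N₀ - Q.eval (N₀ : ℚ)), N₀, fun N hN => ?_⟩
  induction N, hN using Nat.le_induction with
  | base => simp
  | succ N hN ih =>
    have h1 := hP N hN
    have h2 := hQ N
    simp only [Polynomial.eval_add, Polynomial.eval_C, Nat.cast_add, Nat.cast_one] at ih h1 ⊢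
    linarith

theorem exists_polynomial_of_backRec_of_evPoly {f : ℕ → ℚ} (hb : BackRec f) (he : EvPoly f) :
    ∃ P : Polynomial ℚ, ∀ N : ℕ, 1 ≤ N → f N = P.eval (N : ℚ) := by
  obtain ⟨P, N₀, hP⟩ := he
  refine ⟨P, fun N hN => ?_⟩
  exact sub_eq_zero.1 ((hb.sub (BackRec.of_polynomial P)).eq_zero (N₀ := N₀)
    (fun N hN => sub_eq_zero.2 (hP N hN)) N hN)

/-! ### Vector partition functions -/

section VecCount

variable {ι G : Type*} [AddCommGroup G]

/-- The ways to write `b` as a combination `∑ i ∈ s, m i • v i` with `m i ∈ ℕ`. -/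
def vecReps (s : Finset ι) (v : ι → G) (b : G) : Set (ι → ℕ) :=
  {m | (∀ i, i ∉ s → m i = 0) ∧ ∑ i ∈ s, m i • v i = b}

/-- The number of ways to write `b` as a combination `∑ i ∈ s, m i • v i` with `m i ∈ ℕ`. -/
noncomputable def vecCount (s : Finset ι) (v : ι → G) (b : G) : ℤ := (vecReps s v b).ncard

/-- A functional positive on all the vectors bounds every multiplicity by its value at `b`. -/
theorem vecReps_finite {s : Finset ι} {v : ι → G} (ℓ : G →+ ℤ)
    (hℓ : ∀ i ∈ s, 0 < ℓ (v i)) (b : G) : (vecReps s v b).Finite := by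
  classical
  have hs : (Set.pi Set.univ fun i : ι => if i ∈ s then Set.Iic (ℓ b).toNat else {0}).Finite := by
    have h := (Set.Finite.pi' (ι := s) (κ := fun _ => ℕ)
      (t := fun _ => Set.Iic (ℓ b).toNat) fun _ => Set.finite_Iic _)
    refine (h.image fun (g : s → ℕ) i => if hi : i ∈ s then g ⟨i, hi⟩ else 0).subset ?_
    intro m hm
    refine ⟨fun i => m i, fun i => ?_, ?_⟩
    · have := hm i (Set.mem_univ _)
      simpa [i.2] using this
    · funext i
      by_cases hi : i ∈ s
      · simp [hi]
      · have := hm i (Set.mem_univ _)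
        simp only [hi, if_false, Set.mem_singleton_iff] at this
        simp [hi, this]
  refine hs.subset ?_
  rintro m ⟨h0, hm⟩ i -
  by_cases hi : i ∈ s
  · simp only [hi, if_true, Set.mem_Iic]
    have h1 : ∑ j ∈ s, (m j : ℤ) * ℓ (v j) = ℓ b := by
      rw [← hm, map_sum]
      simp
    have h2 : (m i : ℤ) * ℓ (v i) ≤ ℓ b := by
      rw [← h1]
      exact Finset.single_le_sum (f := fun j => (m j : ℤ) * ℓ (v j))
        (fun j hj => mul_nonneg (Int.natCast_nonneg _) (hℓ j hj).le) hi
    have h3 := hℓ i hi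
    have : (m i : ℤ) ≤ ℓ b := by nlinarith [Int.natCast_nonneg (m i)]
    omega
  · simp [hi, h0 i hi]

theorem vecCount_empty [DecidableEq G] (v : ι → G) (b : G) :
    vecCount ∅ v b = if b = 0 then 1 else 0 := by
  unfold vecCount
  split_ifs with h
  · have : vecReps ∅ v b = {0} := by
      ext m
      simp [vecReps, h, funext_iff]
    simp [this]
  · have : vecReps ∅ v b = ∅ := by
      ext m
      simp [vecReps, Ne.symm h]
    simp [this]

theorem vecCount_congr {s : Finset ι} {v w : ι → G} (h : ∀ i ∈ s, v i = w i) (b : G) :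
    vecCount s v b = vecCount s w b := by
  unfold vecCount
  congr 2
  ext m
  simp only [vecReps, Set.mem_ofPred_eq]
  rw [Finset.sum_congr rfl fun i hi => by rw [h i hi]]

theorem vecCount_eq_zero_of_neg {s : Finset ι} {v : ι → G} (c : G →+ ℤ)
    (hc : ∀ i ∈ s, 0 ≤ c (v i)) {b : G} (hb : c b < 0) : vecCount s v b = 0 := by
  have : vecReps s v b = ∅ := by
    rw [Set.eq_empty_iff_forall_notMem]
    rintro m ⟨-, hm⟩
    rw [← hm, map_sum] at hb
    refine absurd hb (not_lt.2 (Finset.sum_nonneg fun i hi => ?_))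
    rw [map_nsmul]
    exact nsmul_nonneg (hc i hi) _
  simp [vecCount, this]

/-- Either `v a` is not used, or one copy of it can be removed. Read as a difference equation, this
says that differencing in the direction `v a` deletes that vector; both halves of the argument rest
on it. -/
theorem vecCount_eq_add [DecidableEq ι] {s : Finset ι} {v : ι → G} (ℓ : G →+ ℤ)
    (hℓ : ∀ i ∈ s, 0 < ℓ (v i)) {a : ι} (ha : a ∈ s) (b : G) :
    vecCount s v b = vecCount (s.erase a) v b + vecCount s v (b - v a) := by
  have hsplit : ∀ m : ι → ℕ, ∑ i ∈ s, m i • v i = m a • v a + ∑ i ∈ s.erase a, m i • v i :=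
    fun m => (Finset.add_sum_erase s _ ha).symm
  have hinj : Function.Injective fun m : ι → ℕ => m + Pi.single a 1 := add_left_injective _
  have hunion : vecReps s v b = vecReps (s.erase a) v b ∪
      (fun m : ι → ℕ => m + Pi.single a 1) '' vecReps s v (b - v a) := by
    ext m
    constructor
    · rintro ⟨h0, hm⟩
      by_cases hma : m a = 0
      · left
        refine ⟨fun i hi => ?_, ?_⟩
        · by_cases hia : i = a
          · rw [hia, hma]
          · exact h0 i fun his => hi (Finset.mem_erase.2 ⟨hia, his⟩)
        · rw [hsplit, hma, zero_smul, zero_add] at hm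
          exact hm
      · right
        have hm1 : m - Pi.single a 1 + Pi.single a 1 = m := by
          funext i
          by_cases hia : i = a
          · subst hia
            simp
            omega
          · simp [hia]
        refine ⟨m - Pi.single a 1, ⟨fun i hi => ?_, ?_⟩, hm1⟩
        · simp [h0 i hi]
        · rw [eq_sub_iff_add_eq, ← hm]
          nth_rewrite 2 [← hm1]
          simp only [Pi.add_apply, add_smul, Finset.sum_add_distrib, add_right_inj]
          rw [Finset.sum_eq_single a]
          · simp
          · intro i _ hia
            simp [hia]
          · exact fun h => absurd ha h
    · rintro (⟨h0, hm⟩ | ⟨m', ⟨h0, hm⟩, rfl⟩)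
      · refine ⟨fun i hi => h0 i fun h => hi (Finset.mem_of_mem_erase h), ?_⟩
        rw [hsplit, h0 a (Finset.notMem_erase a s), zero_smul, zero_add, hm]
      · refine ⟨fun i hi => ?_, ?_⟩
        · have : i ≠ a := fun h => hi (h ▸ ha)
          simp [h0 i hi, this]
        · rw [eq_sub_iff_add_eq] at hm
          rw [← hm]
          simp only [Pi.add_apply, add_smul, Finset.sum_add_distrib, add_right_inj]
          rw [Finset.sum_eq_single a]
          · simp
          · intro i _ hia
            simp [hia]
          · exact fun h => absurd ha h
  have hdisj : Disjoint (vecReps (s.erase a) v b)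
      ((fun m : ι → ℕ => m + Pi.single a 1) '' vecReps s v (b - v a)) := by
    rw [Set.disjoint_left]
    rintro m ⟨h0, -⟩ ⟨m', -, rfl⟩
    have := h0 a (Finset.notMem_erase a s)
    simp at this
  have hfin := vecReps_finite ℓ hℓ (b - v a)
  unfold vecCount
  rw [hunion, Set.ncard_union_eq hdisj
    (vecReps_finite ℓ (fun i hi => hℓ i (Finset.mem_of_mem_erase hi)) b) (hfin.image _),
    Set.ncard_image_of_injective _ hinj, Nat.cast_add]

/-- A function invariant under translation by `v` can be moved into the half-space where it
vanishes. This makes difference operators injective on functions supported in `ℓ ≥ 0`. -/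
theorem eq_zero_of_difference_eq_zero (ℓ : G →+ ℤ) {f : G → ℤ} (hf : ∀ b, ℓ b < 0 → f b = 0)
    {v : G} (hv : 0 < ℓ v) (h : ∀ b, f b - f (b - v) = 0) (b : G) : f b = 0 := by
  have key : ∀ m : ℕ, ∀ b, ℓ b < m → f b = 0 := by
    intro m
    induction m with
    | zero => intro b hb; exact hf b (by simpa using hb)
    | succ m ih =>
      intro b hb
      have h1 := ih (b - v) (by rw [map_sub]; push_cast at hb; omega)
      have h2 := h b
      omega
  exact key ((ℓ b).toNat + 1) b (by push_cast; omega)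

/-- Elliott's reduction: in a combination, the two vectors `v i`, `v j` may be replaced by
`v i`, `v i + v j` (if `v i` occurs at least as often as `v j`) or by `v j`, `v i + v j`. -/
theorem vecCount_elliott [DecidableEq ι] {s : Finset ι} {v : ι → G} (ℓ : G →+ ℤ)
    (hℓ : ∀ i ∈ s, 0 < ℓ (v i)) {i j : ι} (hi : i ∈ s) (hj : j ∈ s) (hij : i ≠ j) (b : G) :
    vecCount s v b = vecCount s (Function.update v j (v i + v j)) b
      + vecCount s (Function.update v i (v i + v j)) b
      - vecCount (s.erase i) (Function.update v j (v i + v j)) b := by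
  set w := v i + v j with hw
  have hwpos : 0 < ℓ w := by rw [hw, map_add]; exact add_pos (hℓ i hi) (hℓ j hj)
  have hpos : ∀ a, ∀ k ∈ s, 0 < ℓ (Function.update v a w k) := by
    intro a k hk
    by_cases hka : k = a
    · rw [hka, Function.update_self]; exact hwpos
    · rw [Function.update_of_ne hka]; exact hℓ k hk
  have hjs : j ∈ s.erase i := Finset.mem_erase.2 ⟨hij.symm, hj⟩
  have his : i ∈ s.erase j := Finset.mem_erase.2 ⟨hij, hi⟩
  have herase : ∀ a, ∀ k ∈ s.erase a, k ∈ s := fun a k hk => Finset.mem_of_mem_erase hk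
  set C : G → ℤ := vecCount ((s.erase i).erase j) v with hC
  have hFi := fun b => vecCount_eq_add ℓ hℓ hi b
  have hFj := fun b => vecCount_eq_add ℓ (fun k hk => hℓ k (herase i k hk)) hjs b
  have hGi := fun b => vecCount_eq_add ℓ (hpos j) hi b
  have hGj := fun b => vecCount_eq_add ℓ (fun k hk => hpos j k (herase i k hk)) hjs b
  have hHj := fun b => vecCount_eq_add ℓ (hpos i) hj b
  have hHi := fun b => vecCount_eq_add ℓ (fun k hk => hpos i k (herase j k hk)) his b
  simp only [Function.update_self, Function.update_of_ne hij, Function.update_of_ne hij.symm]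
    at hGi hGj hHj hHi
  have hC1 : ∀ b, vecCount ((s.erase i).erase j) (Function.update v j w) b = C b := fun b =>
    vecCount_congr (fun k hk => Function.update_of_ne (Finset.ne_of_mem_erase hk) _ _) b
  have hC2 : ∀ b, vecCount ((s.erase j).erase i) (Function.update v i w) b = C b := fun b => by
    rw [Finset.erase_right_comm]
    exact vecCount_congr (fun k hk => Function.update_of_ne
      (Finset.ne_of_mem_erase (Finset.mem_of_mem_erase hk)) _ _) b
  simp only [hC1] at hGj
  simp only [hC2] at hHi
  set F := vecCount s v
  set F' := vecCount (s.erase i) v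
  set A := vecCount s (Function.update v j w)
  set A' := vecCount (s.erase i) (Function.update v j w)
  set B := vecCount s (Function.update v i w)
  set B' := vecCount (s.erase j) (Function.update v i w)
  have hzF : ∀ b, ℓ b < 0 → F b = 0 := fun b hb =>
    vecCount_eq_zero_of_neg ℓ (fun k hk => (hℓ k hk).le) hb
  have hzA : ∀ b, ℓ b < 0 → A b = 0 := fun b hb =>
    vecCount_eq_zero_of_neg ℓ (fun k hk => (hpos j k hk).le) hb
  have hzA' : ∀ b, ℓ b < 0 → A' b = 0 := fun b hb =>
    vecCount_eq_zero_of_neg ℓ (fun k hk => (hpos j k (herase i k hk)).le) hb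
  have hzB : ∀ b, ℓ b < 0 → B b = 0 := fun b hb =>
    vecCount_eq_zero_of_neg ℓ (fun k hk => (hpos i k hk).le) hb
  -- In generating functions the claim is `1/((1-x)(1-y)) = 1/((1-x)(1-xy)) + 1/((1-y)(1-xy)) -
  -- 1/(1-xy)`. The denominators are cleared by differencing along `v i`, `v j` and `w`, and the
  -- three differences are undone at the end.
  let X : G → ℤ := fun b => F b - A b - B b + A' b
  have hX : ∀ b, ℓ b < 0 → X b = 0 := fun b hb => by
    simp [X, hzF b hb, hzA b hb, hzB b hb, hzA' b hb]
  let X1 : G → ℤ := fun b => X b - X (b - v i)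
  let X2 : G → ℤ := fun b => X1 b - X1 (b - v j)
  have hX1 : ∀ b, ℓ b < 0 → X1 b = 0 := fun b hb => by
    have := hX (b - v i) (by rw [map_sub]; have := hℓ i hi; omega)
    simp [X1, hX b hb, this]
  have hX2 : ∀ b, ℓ b < 0 → X2 b = 0 := fun b hb => by
    have := hX1 (b - v j) (by rw [map_sub]; have := hℓ j hj; omega)
    simp [X2, hX1 b hb, this]
  have hX3 : ∀ b, X2 b - X2 (b - w) = 0 := by
    intro b
    have e1 : b - v j - v i = b - w := by rw [hw]; abel
    have e2 : b - v i - v j = b - w := by rw [hw]; abel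
    have e3 : b - w - v i = b - v i - w := by abel
    have e4 : b - w - v j = b - v j - w := by abel
    have e5 : b - v j - w - v i = b - w - w := by rw [hw]; abel
    have e6 : b - v i - w - v j = b - w - w := by rw [hw]; abel
    have f1 := hFi b
    have f2 := hFi (b - v j)
    have f3 := hFi (b - w)
    have f4 := hFi (b - v j - w)
    have f5 := hFj b
    have f6 := hFj (b - w)
    have g1 := hGi b
    have g2 := hGi (b - v j)
    have g3 := hGi (b - w)
    have g4 := hGi (b - v j - w)
    have g5 := hGj b
    have g6 := hGj (b - v j)
    have g7 := hGj (b - v i)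
    have g8 := hGj (b - w)
    have h1 := hHj b
    have h2 := hHj (b - v i)
    have h3 := hHj (b - w)
    have h4 := hHj (b - v i - w)
    have h5 := hHi b
    have h6 := hHi (b - v i)
    have h7 := hHi (b - w)
    simp only [X2, X1, X, e1, e2, e3, e4, e5, e6] at *
    linarith
  have hX4 := eq_zero_of_difference_eq_zero ℓ hX2 hwpos hX3
  have hX5 := eq_zero_of_difference_eq_zero ℓ hX1 (hℓ j hj) hX4
  have hX6 := eq_zero_of_difference_eq_zero ℓ hX (hℓ i hi) hX5 b
  simp only [X] at hX6
  linarith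

end VecCount

/-! ### Counting solutions of homogeneous systems of linear inequalities -/

section Ehrhart

variable {ι J : Type*} [DecidableEq ι]

/-- This is the base of the elimination: only partitions of `N` into fixed positive part sizes are
counted, and differencing by a part size removes that part. With no parts left the count is zero for
`N ≥ 1` but not for `N = 0`, which is why `BackRec` ignores index 0. -/
theorem backRec_vecCount_of_fst_eq_zero (ℓ : (J → ℤ) × ℤ →+ ℤ) (hb : 0 < ℓ (0, 1))
    (s : Finset ι) (v : ι → (J → ℤ) × ℤ) (hℓ : ∀ i ∈ s, 0 < ℓ (v i))
    (h0 : ∀ i ∈ s, (v i).1 = 0) : BackRec (fun N => (vecCount s v (0, (N : ℤ)) : ℚ)) := by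
  classical
  induction s using Finset.induction_on with
  | empty =>
    refine BackRec.of_eq_zero fun N hN => ?_
    have : ((0, (N : ℤ)) : (J → ℤ) × ℤ) ≠ 0 := fun h => by
      have := congrArg Prod.snd h
      simp at this
      omega
    rw [vecCount_empty, if_neg this, Int.cast_zero]
  | insert a s ha ih =>
    have ih' := ih (fun i hi => hℓ i (Finset.mem_insert_of_mem hi))
      (fun i hi => h0 i (Finset.mem_insert_of_mem hi))
    have hva : v a = (0, (v a).2) := Prod.ext (h0 a (Finset.mem_insert_self a s)) rfl
    have hd : 0 < (v a).2 := by
      have h1 := hℓ a (Finset.mem_insert_self a s)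
      have h2 : v a = (v a).2 • ((0, 1) : (J → ℤ) × ℤ) := by
        nth_rewrite 1 [hva]
        simp
      rw [h2, map_zsmul, smul_eq_mul] at h1
      exact pos_of_mul_pos_left h1 hb.le
    obtain ⟨d, hd'⟩ := Int.eq_ofNat_of_zero_le hd.le
    rw [hd'] at hva hd
    refine BackRec.of_difference (d := d) (by omega) ((ih'.shift d).congr fun N _ => ?_)
    have h := vecCount_eq_add ℓ hℓ (Finset.mem_insert_self a s) (0, ((N + d : ℕ) : ℤ))
    rw [Finset.erase_insert ha] at h
    have e : ((0, ((N + d : ℕ) : ℤ)) : (J → ℤ) × ℤ) - v a = (0, (N : ℤ)) := by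
      rw [hva]
      ext <;> simp
    rw [e] at h
    rw [h]
    push_cast
    ring

/-- A sum of non-negative terms `c (v i)` with total zero can only use vectors on the hyperplane `c
= 0`. -/
theorem vecCount_filter_eq {G : Type*} [AddCommGroup G] {s : Finset ι} {v : ι → G} (ℓ : G →+ ℤ)
    (hℓ : ∀ i ∈ s, 0 < ℓ (v i)) (c : G →+ ℤ) (hc : ∀ i ∈ s, 0 ≤ c (v i)) {b : G}
    (hb : c b = 0) : vecCount s v b = vecCount (s.filter fun i => c (v i) = 0) v b := by
  induction hk : (s.filter fun i => c (v i) ≠ 0).card generalizing s with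
  | zero =>
    rw [Finset.card_eq_zero, Finset.filter_eq_empty_iff] at hk
    rw [Finset.filter_true_of_mem]
    intro i hi
    simpa using hk hi
  | succ k ih =>
    obtain ⟨a, ha⟩ := Finset.card_pos.1 (by rw [hk]; omega)
    obtain ⟨has, hca⟩ := Finset.mem_filter.1 ha
    rw [vecCount_eq_add ℓ hℓ has, vecCount_eq_zero_of_neg c hc (b := b - v a), add_zero,
      ih (s := s.erase a)]
    · congr 1
      rw [Finset.filter_erase, Finset.erase_eq_of_notMem]
      simp [hca]
    · exact fun i hi => hℓ i (Finset.mem_of_mem_erase hi)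
    · exact fun i hi => hc i (Finset.mem_of_mem_erase hi)
    · rw [Finset.filter_erase, Finset.card_erase_of_mem ha, hk]
      rfl
    · rw [map_sub, hb]
      have := hc a has
      omega

/-- Coordinates outside `T` are already zero, and the coordinates in `T` are eliminated one at a
time. If all vectors have the same weak sign at `j`, only those vanishing at `j` matter. Otherwise
Elliott's identity is applied to a vector of maximal size at `j` and one of opposite sign, whose sum
is strictly smaller there. Positivity of `ℓ` survives the replacement. -/
theorem backRec_vecCount [DecidableEq J] (ℓ : (J → ℤ) × ℤ →+ ℤ) (hb : 0 < ℓ (0, 1))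
    (T : Finset J) (s : Finset ι) (v : ι → (J → ℤ) × ℤ) (hℓ : ∀ i ∈ s, 0 < ℓ (v i))
    (h0 : ∀ i ∈ s, ∀ j, j ∉ T → (v i).1 j = 0) :
    BackRec (fun N => (vecCount s v (0, (N : ℤ)) : ℚ)) := by
  induction T using Finset.induction_on generalizing s v with
  | empty =>
    exact backRec_vecCount_of_fst_eq_zero ℓ hb s v hℓ
      fun i hi => funext fun j => h0 i hi j (Finset.notMem_empty j)
  | insert j T hj ihT =>
    -- The induction is lexicographic: `M` bounds the size of coordinate `j`, `p` bounds the number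
    -- of vectors attaining that size, and `q` below bounds the number of vectors of sign opposite
    -- to the chosen extremal one.
    have main : ∀ (M p : ℕ) (s : Finset ι) (v : ι → (J → ℤ) × ℤ), (∀ i ∈ s, 0 < ℓ (v i)) →
        (∀ i ∈ s, ∀ k, k ∉ insert j T → (v i).1 k = 0) → (∀ i ∈ s, |(v i).1 j| ≤ M) →
        (s.filter fun i => |(v i).1 j| = M).card ≤ p →
        BackRec (fun N => (vecCount s v (0, (N : ℤ)) : ℚ)) := by
      intro M
      induction M with
      | zero =>
        intro p s v hℓ h0 hM _
        refine ihT s v hℓ fun i hi k hk => ?_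
        by_cases hkj : k = j
        · subst hkj
          exact abs_nonpos_iff.1 (by simpa using hM i hi)
        · exact h0 i hi k fun h => hk ((Finset.mem_insert.1 h).resolve_left hkj)
      | succ M ihM =>
        intro p
        induction p with
        | zero =>
          intro s v hℓ h0 hM hp
          rw [Nat.le_zero, Finset.card_eq_zero, Finset.filter_eq_empty_iff] at hp
          refine ihM s.card s v hℓ h0 (fun i hi => ?_) (Finset.card_filter_le _ _)
          have h1 := hM i hi
          have h2 := hp hi
          push_cast at h1 h2
          omega
        | succ p ihp =>
          -- The sign `ε` normalises the extremal vector to be positive at `j`, treating both signs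
          -- at once.
          have step : ∀ (ε : ℤ), |ε| = 1 → ∀ (q : ℕ) (s : Finset ι) (v : ι → (J → ℤ) × ℤ),
              (∀ i ∈ s, 0 < ℓ (v i)) →
              (∀ i ∈ s, ∀ k, k ∉ insert j T → (v i).1 k = 0) →
              (∀ i ∈ s, |(v i).1 j| ≤ (M + 1 : ℕ)) →
              (s.filter fun i => |(v i).1 j| = (M + 1 : ℕ)).card ≤ p + 1 →
              (∃ i ∈ s, ε * (v i).1 j = (M + 1 : ℕ)) →
              (s.filter fun i => ε * (v i).1 j < 0).card ≤ q →
              BackRec (fun N => (vecCount s v (0, (N : ℤ)) : ℚ)) := by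
            intro ε hε q
            have habs : ∀ z : ℤ, |z| = |ε * z| := fun z => by rw [abs_mul, hε, one_mul]
            have hnonneg : ∀ (s : Finset ι) (v : ι → (J → ℤ) × ℤ), (∀ i ∈ s, 0 < ℓ (v i)) →
                (∀ i ∈ s, ∀ k, k ∉ insert j T → (v i).1 k = 0) →
                (∀ i ∈ s, 0 ≤ ε * (v i).1 j) →
                BackRec (fun N => (vecCount s v (0, (N : ℤ)) : ℚ)) := by
              intro s v hℓ h0 hnn
              let c : (J → ℤ) × ℤ →+ ℤ :=
                { toFun := fun g => ε * g.1 j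
                  map_zero' := by simp
                  map_add' := fun a b => by simp [mul_add] }
              refine (ihT (s.filter fun i => c (v i) = 0) v
                (fun i hi => hℓ i (Finset.mem_of_mem_filter i hi)) ?_).congr fun N _ => ?_
              · intro i hi k hk
                obtain ⟨his, hci⟩ := Finset.mem_filter.1 hi
                by_cases hkj : k = j
                · subst hkj
                  have h1 : ε * (v i).1 k = 0 := hci
                  rw [← abs_eq_zero, habs, h1, abs_zero]
                · exact h0 i his k fun h => hk ((Finset.mem_insert.1 h).resolve_left hkj)
              · rw [vecCount_filter_eq ℓ hℓ c hnn (b := (0, (N : ℤ)))]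
                change ε * 0 = 0
                simp
            induction q with
            | zero =>
              intro s v hℓ h0 _ _ _ hq
              rw [Nat.le_zero, Finset.card_eq_zero, Finset.filter_eq_empty_iff] at hq
              exact hnonneg s v hℓ h0 fun i hi => not_lt.1 (hq hi)
            | succ q ihq =>
              intro s v hℓ h0 hM hp hex hq
              by_cases hneg : ∀ i ∈ s, 0 ≤ ε * (v i).1 j
              · exact hnonneg s v hℓ h0 hneg
              push Not at hneg
              obtain ⟨k, hk, hkneg⟩ := hneg
              obtain ⟨i, hi, himax⟩ := hex
              have hik : i ≠ k := by
                rintro rfl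
                rw [himax] at hkneg
                omega
              have hkM := hM k hk
              rw [habs, abs_of_neg hkneg] at hkM
              have hw : ε * (v i + v k).1 j = (M + 1 : ℕ) + ε * (v k).1 j := by
                rw [Prod.fst_add, Pi.add_apply, mul_add, himax]
              have hw0 : 0 ≤ ε * (v i + v k).1 j := by rw [hw]; omega
              have hwabs : |(v i + v k).1 j| < (M + 1 : ℕ) := by
                rw [habs, abs_of_nonneg hw0, hw]
                omega
              have hpos : ∀ a, ∀ l ∈ s, 0 < ℓ (Function.update v a (v i + v k) l) := by
                intro a l hl
                by_cases hla : l = a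
                · rw [hla, Function.update_self, map_add]
                  exact add_pos (hℓ i hi) (hℓ k hk)
                · rw [Function.update_of_ne hla]; exact hℓ l hl
              have hzero : ∀ a, ∀ l ∈ s, ∀ k', k' ∉ insert j T →
                  (Function.update v a (v i + v k) l).1 k' = 0 := by
                intro a l hl k' hk'
                by_cases hla : l = a
                · rw [hla, Function.update_self, Prod.fst_add, Pi.add_apply, h0 i hi k' hk',
                    h0 k hk k' hk', add_zero]
                · rw [Function.update_of_ne hla]; exact h0 l hl k' hk'
              have hbd : ∀ a, ∀ l ∈ s,
                  |(Function.update v a (v i + v k) l).1 j| ≤ (M + 1 : ℕ) := by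
                intro a l hl
                by_cases hla : l = a
                · rw [hla, Function.update_self]; exact hwabs.le
                · rw [Function.update_of_ne hla]; exact hM l hl
              have hsub : ∀ a, (s.filter fun l =>
                  |(Function.update v a (v i + v k) l).1 j| = (M + 1 : ℕ)) ⊆
                  (s.filter fun l => |(v l).1 j| = (M + 1 : ℕ)).erase a := by
                intro a l hl
                obtain ⟨hls, hl2⟩ := Finset.mem_filter.1 hl
                by_cases hla : l = a
                · rw [hla, Function.update_self] at hl2
                  omega
                · rw [Function.update_of_ne hla] at hl2
                  exact Finset.mem_erase.2 ⟨hla, Finset.mem_filter.2 ⟨hls, hl2⟩⟩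
              -- Replacing `v k` keeps the extremal vector `v i` and removes one negative vector, so
              -- `q` drops. In the two remaining terms `v i` itself disappears, so `p` drops.
              have hA := ihq s (Function.update v k (v i + v k)) (hpos k) (hzero k) (hbd k)
                ((Finset.card_le_card ((hsub k).trans (Finset.erase_subset _ _))).trans hp)
                ⟨i, hi, by rw [Function.update_of_ne hik]; exact himax⟩ (by
                  have hsub' : (s.filter fun l =>
                      ε * (Function.update v k (v i + v k) l).1 j < 0) ⊆
                      (s.filter fun l => ε * (v l).1 j < 0).erase k := by
                    intro l hl
                    obtain ⟨hls, hl2⟩ := Finset.mem_filter.1 hl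
                    by_cases hla : l = k
                    · rw [hla, Function.update_self] at hl2
                      omega
                    · rw [Function.update_of_ne hla] at hl2
                      exact Finset.mem_erase.2 ⟨hla, Finset.mem_filter.2 ⟨hls, hl2⟩⟩
                  have h1 := Finset.card_le_card hsub'
                  rw [Finset.card_erase_of_mem (Finset.mem_filter.2 ⟨hk, hkneg⟩)] at h1
                  omega)
              have himem : i ∈ s.filter fun l => |(v l).1 j| = (M + 1 : ℕ) := by
                refine Finset.mem_filter.2 ⟨hi, ?_⟩
                rw [habs, himax]
                exact abs_of_nonneg (by omega)
              have hB := ihp s (Function.update v i (v i + v k)) (hpos i) (hzero i) (hbd i) (by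
                have h1 := Finset.card_le_card (hsub i)
                rw [Finset.card_erase_of_mem himem] at h1
                omega)
              have hC := ihp (s.erase i) (Function.update v k (v i + v k))
                (fun l hl => hpos k l (Finset.mem_of_mem_erase hl))
                (fun l hl => hzero k l (Finset.mem_of_mem_erase hl))
                (fun l hl => hbd k l (Finset.mem_of_mem_erase hl)) (by
                  rw [Finset.filter_erase]
                  have h1 := Finset.card_le_card (Finset.erase_subset_erase i
                    ((hsub k).trans (Finset.erase_subset _ _)))
                  rw [Finset.card_erase_of_mem himem] at h1
                  omega)
              refine ((hA.add hB).sub hC).congr fun N _ => ?_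
              rw [vecCount_elliott ℓ hℓ hi hk hik]
              simp
          intro s v hℓ h0 hM hp
          by_cases hex : ∃ i ∈ s, |(v i).1 j| = (M + 1 : ℕ)
          · obtain ⟨i, hi, him⟩ := hex
            rcases abs_choice ((v i).1 j) with h | h
            · exact step 1 (by simp) _ s v hℓ h0 hM hp ⟨i, hi, by rw [one_mul, ← h, him]⟩ le_rfl
            · exact step (-1) (by simp) _ s v hℓ h0 hM hp
                ⟨i, hi, by rw [neg_one_mul, ← h, him]⟩ le_rfl
          · push Not at hex
            refine ihM s.card s v hℓ h0 (fun i hi => ?_) (Finset.card_filter_le _ _)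
            have h1 := hM i hi
            have h2 := hex i hi
            push_cast at h1 h2
            omega
    exact main (s.sup fun i => ((v i).1 j).natAbs) s.card s v hℓ h0 (fun i hi => by
      rw [Int.abs_eq_natAbs]
      exact_mod_cast Finset.le_sup (f := fun i => ((v i).1 j).natAbs) hi)
      (Finset.card_filter_le _ _)

/-- The number of solutions in natural numbers of a homogeneous system of linear inequalities in
`x` and `N`, one of which bounds `∑ x i` by a multiple of `N`, is backward recursive in `N`. -/
theorem backRec_ncard_solutions {I J : Type*} [Fintype I] [Fintype J] (a : J → I → ℤ)
    (c : J → ℤ) (M : ℕ) : BackRec (fun N => (({x : I → ℕ | ∑ i, x i ≤ M * N ∧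
      ∀ j, 0 ≤ ∑ i, a j i * (x i : ℤ) + c j * (N : ℤ)}.ncard : ℕ) : ℚ)) := by
  classical
  -- The index `none` carries the bound `M N - ∑ x i ≥ 0`; the indices `some j` carry the given
  -- inequalities.
  let a' : Option J → I → ℤ := fun o i => o.elim (-1) fun j => a j i
  let c' : Option J → ℤ := fun o => o.elim (M : ℤ) c
  -- The vectors are the columns for the unknowns `x`, one slack column for each inequality, and the
  -- column of `N`. The last coordinate of the target forces the column of `N` to be used exactly
  -- `N` times.
  let v : (I ⊕ Option J) ⊕ Unit → (Option J → ℤ) × ℤ :=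
    Sum.elim (Sum.elim (fun i => (fun o => a' o i, 0)) fun o => (-Pi.single o 1, 0))
      fun _ => (c', 1)
  -- `K` and `B` are chosen large enough for `ℓ` to be positive on every column: `K` dominates the
  -- columns of the unknowns by means of the bound inequality, and `B` dominates the column of `N`.
  let K : ℤ := 1 + ∑ j, ∑ i, |a j i|
  let B : ℤ := 1 + K * M + ∑ j, |c j|
  let ℓ : (Option J → ℤ) × ℤ →+ ℤ :=
    { toFun := fun g => -(K * g.1 none) - ∑ j, g.1 (some j) + B * g.2
      map_zero' := by simp
      map_add' := fun g h => by
        simp only [Prod.fst_add, Prod.snd_add, Pi.add_apply, Finset.sum_add_distrib]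
        ring }
  have hℓ_def : ∀ g, ℓ g = -(K * g.1 none) - ∑ j, g.1 (some j) + B * g.2 := fun g => rfl
  have hK : 0 < K := by
    have : 0 ≤ ∑ j, ∑ i, |a j i| :=
      Finset.sum_nonneg fun j _ => Finset.sum_nonneg fun i _ => abs_nonneg _
    omega
  have hB : 0 < B := by
    have h1 : 0 ≤ ∑ j, |c j| := Finset.sum_nonneg fun j _ => abs_nonneg _
    have h2 : 0 ≤ K * M := mul_nonneg hK.le (Int.natCast_nonneg _)
    omega
  have hpos : ∀ i ∈ (Finset.univ : Finset ((I ⊕ Option J) ⊕ Unit)), 0 < ℓ (v i) := by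
    rintro ((i | (_ | j)) | u) -
    · rw [hℓ_def]
      have h1 : ∑ j, a j i ≤ ∑ j, ∑ i, |a j i| := Finset.sum_le_sum fun j _ =>
        (le_abs_self _).trans (Finset.single_le_sum (f := fun i => |a j i|)
          (fun i _ => abs_nonneg _) (Finset.mem_univ i))
      simp only [v, a', Sum.elim_inl, Option.elim]
      simp only [K]
      linarith
    · rw [hℓ_def]
      simp [v, hK]
    · rw [hℓ_def]
      simp [v, Pi.single_apply]
    · rw [hℓ_def]
      have h1 : ∑ j, c j ≤ ∑ j, |c j| := Finset.sum_le_sum fun j _ => le_abs_self _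
      simp only [v, c', Sum.elim_inr, Option.elim]
      simp only [B]
      linarith
  have hb : 0 < ℓ (0, 1) := by
    rw [hℓ_def]
    simpa using hB
  refine (backRec_vecCount ℓ hb Finset.univ Finset.univ v hpos
    (fun i _ j hj => absurd (Finset.mem_univ j) hj)).congr fun N _ => ?_
  unfold vecCount
  rw [Int.cast_natCast, Nat.cast_inj]
  have hmem : ∀ m : (I ⊕ Option J) ⊕ Unit → ℕ, m ∈ vecReps Finset.univ v (0, (N : ℤ)) ↔
      m (Sum.inr ()) = N ∧ ∀ o, (m (Sum.inl (Sum.inr o)) : ℤ)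
        = ∑ i, a' o i * (m (Sum.inl (Sum.inl i)) : ℤ) + c' o * (N : ℤ) := by
    intro m
    simp only [vecReps, Set.mem_ofPred_eq, Finset.mem_univ, not_true, false_imp_iff,
      implies_true, true_and, Prod.ext_iff, funext_iff, Fintype.sum_sum_type, v, Sum.elim_inl,
      Sum.elim_inr, Prod.fst_add, Prod.snd_add, Prod.fst_sum, Prod.snd_sum, Prod.smul_fst,
      Prod.smul_snd, Pi.add_apply, Finset.sum_apply, Pi.smul_apply, Pi.neg_apply,
      Finset.univ_unique, Finset.sum_singleton, Pi.single_apply, Pi.zero_apply]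
    simp only [nsmul_eq_mul, mul_zero, Finset.sum_const_zero, zero_add, mul_one]
    constructor
    · rintro ⟨h1, h2⟩
      have h2' : m (Sum.inr ()) = N := by exact_mod_cast h2
      refine ⟨h2', fun o => ?_⟩
      have h3 := h1 o
      simp only [mul_neg, mul_ite, mul_one, mul_zero, Finset.sum_neg_distrib,
        Finset.sum_ite_eq, Finset.mem_univ, if_true] at h3
      have h4 : (m (Sum.inr default) : ℤ) = N := by exact_mod_cast h2'
      rw [h4] at h3
      simp only [mul_comm (a' o _)]
      linarith
    · rintro ⟨h1, h2⟩
      have h4 : (m (Sum.inr default) : ℤ) = N := by exact_mod_cast h1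
      refine ⟨fun o => ?_, h4⟩
      have h3 := h2 o
      simp only [mul_neg, mul_ite, mul_one, mul_zero, Finset.sum_neg_distrib,
        Finset.sum_ite_eq, Finset.mem_univ, if_true]
      rw [h4]
      simp only [mul_comm (a' o _)] at h3
      linarith
  have himg : {x : I → ℕ | ∑ i, x i ≤ M * N ∧
      ∀ j, 0 ≤ ∑ i, a j i * (x i : ℤ) + c j * (N : ℤ)}
      = (fun m i => m (Sum.inl (Sum.inl i))) '' vecReps Finset.univ v (0, (N : ℤ)) := by
    ext x
    constructor
    · rintro ⟨h1, h2⟩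
      refine ⟨Sum.elim (Sum.elim x fun o => (∑ i, a' o i * (x i : ℤ) + c' o * (N : ℤ)).toNat)
        fun _ => N, (hmem _).2 ⟨rfl, ?_⟩, rfl⟩
      rintro (_ | j)
      · refine Int.toNat_of_nonneg ?_
        simp only [a', c', Option.elim, neg_one_mul, Finset.sum_neg_distrib]
        have : ∑ i, (x i : ℤ) ≤ M * N := by exact_mod_cast h1
        linarith
      · exact Int.toNat_of_nonneg (h2 j)
    · rintro ⟨m, hm, rfl⟩
      obtain ⟨-, h2⟩ := (hmem m).1 hm
      refine ⟨?_, fun j => ?_⟩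
      · have h3 := h2 none
        simp only [a', c', Option.elim, neg_one_mul, Finset.sum_neg_distrib] at h3
        have : ∑ i, (m (Sum.inl (Sum.inl i)) : ℤ) ≤ M * N := by
          linarith [Int.natCast_nonneg (m (Sum.inl (Sum.inr none)))]
        exact_mod_cast this
      · exact (Int.natCast_nonneg _).trans_eq (h2 (some j))
  rw [himg, Set.InjOn.ncard_image]
  intro m hm m' hm' h
  obtain ⟨h1, h2⟩ := (hmem m).1 hm
  obtain ⟨h1', h2'⟩ := (hmem m').1 hm'
  have hI : ∀ i, m (Sum.inl (Sum.inl i)) = m' (Sum.inl (Sum.inl i)) := fun i => congrFun h i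
  funext k
  rcases k with ((i | o) | u)
  · exact hI i
  · have := (h2 o).trans ((by simp only [hI]) : _ = _) |>.trans (h2' o).symm
    exact_mod_cast this
  · exact h1.trans h1'.symm

/-! ### Homogeneous linear forms and cones -/

/-- A linear form in `x` and `N`. -/
def IsHomForm {I : Type*} [Fintype I] (g : ℕ → (I → ℕ) → ℤ) : Prop :=
  ∃ (a : I → ℤ) (c : ℤ), ∀ N x, g N x = ∑ i, a i * (x i : ℤ) + c * (N : ℤ)

/-- A condition on `x` and `N` given by finitely many homogeneous linear inequalities. -/
def IsHomCone {I : Type*} [Fintype I] (S : ℕ → (I → ℕ) → Prop) : Prop :=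
  ∃ (J : Type) (_ : Fintype J) (a : J → I → ℤ) (c : J → ℤ),
    ∀ N x, S N x ↔ ∀ j, 0 ≤ ∑ i, a j i * (x i : ℤ) + c j * (N : ℤ)

section

variable {I : Type*} [Fintype I]

theorem IsHomForm.coord (i : I) : IsHomForm fun _ x => ((x i : ℕ) : ℤ) := by
  classical
  exact ⟨Pi.single i 1, 0, fun N x => by simp [Pi.single_apply]⟩

theorem IsHomForm.natCast_mul (c : ℤ) : IsHomForm (I := I) fun N _ => (N : ℤ) * c :=
  ⟨0, c, fun N x => by simp [mul_comm]⟩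

theorem IsHomForm.zero : IsHomForm (I := I) fun _ _ => 0 := ⟨0, 0, by simp⟩

theorem IsHomForm.add {g h : ℕ → (I → ℕ) → ℤ} (hg : IsHomForm g) (hh : IsHomForm h) :
    IsHomForm fun N x => g N x + h N x := by
  obtain ⟨a, c, hg⟩ := hg
  obtain ⟨b, d, hh⟩ := hh
  refine ⟨a + b, c + d, fun N x => ?_⟩
  simp only [hg, hh, Pi.add_apply, add_mul, Finset.sum_add_distrib]
  ring

theorem IsHomForm.neg {g : ℕ → (I → ℕ) → ℤ} (hg : IsHomForm g) :
    IsHomForm fun N x => -g N x := by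
  obtain ⟨a, c, hg⟩ := hg
  refine ⟨-a, -c, fun N x => ?_⟩
  simp only [hg, Pi.neg_apply, neg_mul, Finset.sum_neg_distrib]
  ring

theorem IsHomForm.sub {g h : ℕ → (I → ℕ) → ℤ} (hg : IsHomForm g) (hh : IsHomForm h) :
    IsHomForm fun N x => g N x - h N x := by
  simp only [sub_eq_add_neg]
  exact hg.add hh.neg

theorem IsHomForm.sum {κ : Type*} (s : Finset κ) {g : κ → ℕ → (I → ℕ) → ℤ}
    (h : ∀ k ∈ s, IsHomForm (g k)) : IsHomForm fun N x => ∑ k ∈ s, g k N x := by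
  classical
  induction s using Finset.induction_on with
  | empty => simpa using IsHomForm.zero
  | insert a s ha ih =>
    simp only [Finset.sum_insert ha]
    exact (h a (Finset.mem_insert_self a s)).add
      (ih fun k hk => h k (Finset.mem_insert_of_mem hk))

theorem IsHomForm.le {g h : ℕ → (I → ℕ) → ℤ} (hg : IsHomForm g) (hh : IsHomForm h) :
    IsHomCone fun N x => g N x ≤ h N x := by
  obtain ⟨a, c, h'⟩ := hh.sub hg
  exact ⟨Unit, inferInstance, fun _ => a, fun _ => c, fun N x => by
    have h1 : g N x ≤ h N x ↔ 0 ≤ h N x - g N x := sub_nonneg.symm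
    simp only [h1, h', forall_const]⟩

theorem IsHomCone.and {S T : ℕ → (I → ℕ) → Prop} (hS : IsHomCone S) (hT : IsHomCone T) :
    IsHomCone fun N x => S N x ∧ T N x := by
  obtain ⟨J, _, a, c, hS⟩ := hS
  obtain ⟨K, _, b, d, hT⟩ := hT
  exact ⟨J ⊕ K, inferInstance, Sum.elim a b, Sum.elim c d, fun N x => by simp [hS, hT]⟩

theorem IsHomForm.eq {g h : ℕ → (I → ℕ) → ℤ} (hg : IsHomForm g) (hh : IsHomForm h) :
    IsHomCone fun N x => g N x = h N x := by
  simp only [le_antisymm_iff]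
  exact (hg.le hh).and (hh.le hg)

theorem IsHomCone.forall {κ : Type} [Finite κ] {S : κ → ℕ → (I → ℕ) → Prop}
    (hS : ∀ k, IsHomCone (S k)) : IsHomCone fun N x => ∀ k, S k N x := by
  cases nonempty_fintype κ
  choose J hJ a c h using hS
  exact ⟨Σ k, J k, inferInstance, fun p => a p.1 p.2, fun p => c p.1 p.2, fun N x => by
    simp [h, Sigma.forall]⟩

theorem IsHomCone.imp {p : Prop} {S : ℕ → (I → ℕ) → Prop} (hS : p → IsHomCone S) :
    IsHomCone fun N x => p → S N x := by
  by_cases hp : p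
  · simpa [hp] using hS hp
  · exact ⟨Empty, inferInstance, Empty.elim, Empty.elim, by simp [hp]⟩

theorem IsHomCone.backRec_ncard {S : ℕ → (I → ℕ) → Prop} (hS : IsHomCone S) (M : ℕ)
    (hM : ∀ N x, S N x → ∀ i, x i ≤ N * M) :
    BackRec fun N => (({x | S N x}.ncard : ℕ) : ℚ) := by
  obtain ⟨J, _, a, c, h⟩ := hS
  refine (backRec_ncard_solutions a c (Fintype.card I * M)).congr fun N _ => ?_
  congr 2
  ext x
  simp only [Set.mem_ofPred_eq, ← h]
  refine ⟨fun hx => ⟨?_, hx⟩, fun hx => hx.2⟩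
  calc ∑ i, x i ≤ ∑ _i : I, N * M := Finset.sum_le_sum fun i _ => hM N x hx i
    _ = Fintype.card I * M * N := by simp; ring

end

end Ehrhart

/-! ### Kostant's partition function -/

/-- The root `e i - e j`. -/
def rootVec {n : ℕ} (p : RootPair n) : Fin n → ℤ := Pi.single p.1.1 1 - Pi.single p.1.2 1

/-- The pairing with `(0, -1, -2, …)`, which is positive on the roots `e i - e j`, `i < j`. -/
def rootHeight (n : ℕ) : (Fin n → ℤ) →+ ℤ where
  toFun g := -∑ i : Fin n, (i : ℤ) * g i
  map_zero' := by simp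
  map_add' g h := by
    simp only [Pi.add_apply, mul_add, Finset.sum_add_distrib]
    ring

theorem rootHeight_rootVec_pos {n : ℕ} (p : RootPair n) : 0 < rootHeight n (rootVec p) := by
  have h : rootHeight n (rootVec p) = ((p.1.2 : ℕ) : ℤ) - ((p.1.1 : ℕ) : ℤ) := by
    simp [rootHeight, rootVec, mul_sub, Pi.single_apply]
  have h2 : ((p.1.1 : ℕ) : ℤ) < ((p.1.2 : ℕ) : ℤ) := by exact_mod_cast p.2
  omega

theorem eval_one_qKostant {n : ℕ} (γ : Fin n → ℤ) :
    (qKostant γ).eval 1 = vecCount Finset.univ rootVec γ := by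
  have h : vecReps Finset.univ rootVec γ = kostantPartitions γ := by
    ext m
    simp [vecReps, kostantPartitions, rootVec]
  unfold qKostant vecCount
  rw [h, Polynomial.eval_finsetSum]
  simp only [Polynomial.eval_pow, Polynomial.eval_X, one_pow, Finset.sum_const, nsmul_eq_mul,
    mul_one]
  rw [Set.ncard_eq_toFinset_card _ (kostantPartitions_finite γ)]

/-- The subgroup generated by a set of roots of type `A` is saturated. -/
theorem mem_closure_rootVec_of_smul_mem {n : ℕ} (s : Set (RootPair n)) {g : Fin n → ℤ} {k : ℤ}
    (hk : k ≠ 0) (h : k • g ∈ AddSubgroup.closure (rootVec '' s)) :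
    g ∈ AddSubgroup.closure (rootVec '' s) := by
  classical
  set H := AddSubgroup.closure (rootVec '' s) with hH
  let e : Fin n → Fin n → ℤ := fun i => Pi.single i 1
  -- These classes are the connected components of the graph whose edges are the roots in `s`. The
  -- map `T` below sends every basis vector to that of its component's representative, and the
  -- subgroup turns out to be the kernel of `T`; this kernel is saturated because `ℤ ^ n` is torsion
  -- free.
  let r : Setoid (Fin n) :=
    { r := fun i j => e i - e j ∈ H
      iseqv := ⟨fun i => by simp [H.zero_mem], fun {i j} h => by
        rw [← neg_sub]; exact H.neg_mem h, fun {i j k} h1 h2 => by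
        have := H.add_mem h1 h2
        rwa [sub_add_sub_cancel] at this⟩ }
  let rep : Fin n → Fin n := fun i => (Quotient.mk r i).out
  have hrep : ∀ i, e i - e (rep i) ∈ H := fun i =>
    r.symm (Quotient.mk_out (s := r) i)
  let T : (Fin n → ℤ) →+ (Fin n → ℤ) :=
    { toFun := fun g => ∑ i, g i • e (rep i)
      map_zero' := by simp
      map_add' := fun a b => by simp [add_smul, Finset.sum_add_distrib] }
  have hTe : ∀ i, T (e i) = e (rep i) := fun i => by
    change ∑ j, (Pi.single i 1 : Fin n → ℤ) j • e (rep j) = _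
    rw [Finset.sum_eq_single i]
    · simp
    · intro j _ hj
      simp [hj]
    · simp
  have hT0 : H ≤ T.ker := by
    rw [hH, AddSubgroup.closure_le]
    rintro _ ⟨p, hp, rfl⟩
    have h1 : e p.1.1 - e p.1.2 ∈ H := AddSubgroup.subset_closure ⟨p, hp, rfl⟩
    have h2 : rep p.1.1 = rep p.1.2 := by
      have : Quotient.mk r p.1.1 = Quotient.mk r p.1.2 := Quotient.sound h1
      simp only [rep, this]
    change T (e p.1.1 - e p.1.2) = 0
    rw [map_sub, hTe, hTe, h2, sub_self]
  have hTg : T g = 0 := by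
    have h1 : T (k • g) = 0 := hT0 h
    rw [map_zsmul] at h1
    exact (smul_eq_zero.1 h1).resolve_left hk
  have hg : g = ∑ i, g i • (e i - e (rep i)) + T g := by
    change g = _ + ∑ i, g i • e (rep i)
    simp only [smul_sub, Finset.sum_sub_distrib, sub_add_cancel]
    funext j
    simp [e, Pi.single_apply]
  rw [hg, hTg, add_zero]
  exact H.sum_mem fun i _ => H.zsmul_mem (hrep i) _

/-- Induction on the set of roots: a difference in a root direction is the count for fewer roots. If
`b` lies in the root lattice of `s`, the difference in direction `b` is a finite combination of such
differences. If not, saturation lets the ray meet that lattice at most once, so the count is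
eventually zero. -/
theorem evPoly_vecCount_rootVec {n : ℕ} (s : Finset (RootPair n)) (b c : Fin n → ℤ) :
    EvPoly fun N => (vecCount s rootVec ((N : ℤ) • b + c) : ℚ) := by
  classical
  induction s using Finset.strongInduction generalizing c with
  | H s ih =>
  by_cases hb : b ∈ AddSubgroup.closure (rootVec '' (s : Set (RootPair n)))
  · have key : ∀ g ∈ AddSubgroup.closure (rootVec '' (s : Set (RootPair n))), ∀ c,
        EvPoly fun N => (vecCount s rootVec ((N : ℤ) • b + (c + g)) : ℚ)
          - vecCount s rootVec ((N : ℤ) • b + c) := by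
      intro g hg
      induction hg using AddSubgroup.closure_induction with
      | mem g hg =>
        obtain ⟨p, hp, rfl⟩ := hg
        intro c
        refine (congrArg EvPoly (funext fun N => ?_)).mpr
          (ih _ (Finset.erase_ssubset hp) (c + rootVec p))
        rw [vecCount_eq_add (rootHeight n) (fun q _ => rootHeight_rootVec_pos q) hp
          ((N : ℤ) • b + (c + rootVec p))]
        have : (N : ℤ) • b + (c + rootVec p) - rootVec p = (N : ℤ) • b + c := by abel
        rw [this]
        push_cast
        ring
      | zero =>
        intro c
        exact ⟨0, 0, fun N _ => by simp⟩
      | add x y _ _ hx hy =>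
        intro c
        refine (congrArg EvPoly (funext fun N => ?_)).mpr ((hx c).add (hy (c + x)))
        rw [add_assoc c x y]
        ring
      | neg x _ hx =>
        intro c
        refine (congrArg EvPoly (funext fun N => ?_)).mpr ((hx (c + -x)).const_mul (-1))
        rw [neg_add_cancel_right]
        ring
    refine EvPoly.of_difference ((congrArg EvPoly (funext fun N => ?_)).mpr (key b hb c))
    have : ((N + 1 : ℕ) : ℤ) • b + c = (N : ℤ) • b + (c + b) := by
      push_cast
      rw [add_smul, one_smul]
      abel
    rw [this]
  · have hz : ∀ β, β ∉ AddSubgroup.closure (rootVec '' (s : Set (RootPair n))) →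
        vecCount s rootVec β = 0 := by
      intro β hβ
      have : vecReps s rootVec β = ∅ := by
        rw [Set.eq_empty_iff_forall_notMem]
        rintro m ⟨-, hm⟩
        refine hβ (hm ▸ AddSubgroup.sum_mem _ fun p hp => AddSubgroup.nsmul_mem _
          (AddSubgroup.subset_closure (Set.mem_image_of_mem _ hp)) _)
      simp [vecCount, this]
    -- Two lattice points on the ray would put a non-zero multiple of `b` in the lattice, hence `b`
    -- itself by saturation.
    have hone : ∀ N N' : ℕ, (N : ℤ) • b + c ∈ AddSubgroup.closure (rootVec '' (s : Set _)) →
        (N' : ℤ) • b + c ∈ AddSubgroup.closure (rootVec '' (s : Set _)) → N = N' := by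
      intro N N' h h'
      by_contra hne
      refine hb (mem_closure_rootVec_of_smul_mem _ (k := (N : ℤ) - N') ?_ ?_)
      · rw [sub_ne_zero]
        exact_mod_cast hne
      · have := AddSubgroup.sub_mem _ h h'
        rwa [add_sub_add_right_eq_sub, ← sub_smul] at this
    by_cases hex : ∃ N₁ : ℕ, (N₁ : ℤ) • b + c ∈ AddSubgroup.closure (rootVec '' (s : Set _))
    · obtain ⟨N₁, hN₁⟩ := hex
      refine ⟨0, N₁ + 1, fun N hN => ?_⟩
      have h0 := hz ((N : ℤ) • b + c) fun h => by
        have := hone N N₁ h hN₁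
        omega
      simpa using h0
    · push Not at hex
      exact ⟨0, 0, fun N _ => by simpa using hz _ (hex N)⟩

/-! ### Coefficient extraction by Kostant's partition function -/

/-- The linear functional `x ^ γ ↦ f γ` on polynomials. -/
noncomputable def monomialSum {n : ℕ} (f : (Fin n → ℤ) → ℤ) : MvPolynomial (Fin n) ℤ →ₗ[ℤ] ℤ :=
  (MvPolynomial.basisMonomials (Fin n) ℤ).constr ℤ fun d => f fun i => (d i : ℤ)

theorem monomialSum_monomial {n : ℕ} (f : (Fin n → ℤ) → ℤ) (d : Fin n →₀ ℕ) (a : ℤ) :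
    monomialSum f (MvPolynomial.monomial d a) = a * f fun i => (d i : ℤ) := by
  have h1 : (MvPolynomial.monomial d a : MvPolynomial (Fin n) ℤ)
      = a • MvPolynomial.basisMonomials (Fin n) ℤ d := by
    rw [MvPolynomial.coe_basisMonomials, MvPolynomial.smul_monomial, smul_eq_mul, mul_one]
  rw [h1, map_smul, monomialSum, Module.Basis.constr_basis, smul_eq_mul]

theorem monomialSum_alternant_mul {n : ℕ} (f : (Fin n → ℤ) → ℤ) (α : Fin n → ℕ)
    (g : MvPolynomial (Fin n) ℤ) :
    monomialSum f (alternant α * g) = ∑ w : Equiv.Perm (Fin n),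
      ((Equiv.Perm.sign w : ℤˣ) : ℤ) * monomialSum (fun γ => f (γ + fun i => (α (w i) : ℤ))) g := by
  induction g using MvPolynomial.induction_on' with
  | monomial d a =>
    rw [alternant_eq_sum, Finset.sum_mul, map_sum]
    refine Finset.sum_congr rfl fun w _ => ?_
    rw [smul_mul_assoc, map_smul, MvPolynomial.monomial_mul, monomialSum_monomial,
      monomialSum_monomial, smul_eq_mul, one_mul]
    congr 3
    funext i
    simp [add_comm]
  | add p q hp hq =>
    rw [mul_add, map_add, hp, hq, ← Finset.sum_add_distrib]
    simp only [map_add, mul_add]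

theorem monomialSum_alternant {n : ℕ} (f : (Fin n → ℤ) → ℤ) (α : Fin n → ℕ) :
    monomialSum f (alternant α) = ∑ w : Equiv.Perm (Fin n),
      ((Equiv.Perm.sign w : ℤˣ) : ℤ) * f fun i => (α (w i) : ℤ) := by
  have h := monomialSum_alternant_mul f α 1
  have h1 : (1 : MvPolynomial (Fin n) ℤ) = MvPolynomial.monomial 0 1 := rfl
  rw [mul_one] at h
  rw [h]
  simp only [h1, monomialSum_monomial, one_mul]
  refine Finset.sum_congr rfl fun w _ => ?_
  congr 2
  funext i
  simp

theorem monomialSum_vecCount_empty {n : ℕ} (d : Fin n →₀ ℕ) (g : MvPolynomial (Fin n) ℤ) :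
    monomialSum (fun γ => vecCount (∅ : Finset (RootPair n)) rootVec (γ - fun i => (d i : ℤ))) g
      = g.coeff d := by
  induction g using MvPolynomial.induction_on' with
  | monomial e a =>
    rw [monomialSum_monomial, vecCount_empty, MvPolynomial.coeff_monomial]
    have : ((fun i => (e i : ℤ)) - fun i => (d i : ℤ)) = 0 ↔ e = d := by
      rw [sub_eq_zero, funext_iff, Finsupp.ext_iff]
      simp
    simp [this]
  | add p q hp hq => rw [map_add, hp, hq, MvPolynomial.coeff_add]

/-- Multiplication by `X i - X j` is adjoint to a difference operator along the root `e i - e j`, up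
to a shift. -/
theorem monomialSum_X_sub_X_mul {n : ℕ} (f : (Fin n → ℤ) → ℤ) (i j : Fin n)
    (g : MvPolynomial (Fin n) ℤ) :
    monomialSum f ((MvPolynomial.X i - MvPolynomial.X j) * g)
      = monomialSum (fun γ => f (γ + Pi.single i 1) - f (γ + Pi.single j 1)) g := by
  induction g using MvPolynomial.induction_on' with
  | monomial e a =>
    have h : ∀ k : Fin n, monomialSum f (MvPolynomial.X k * MvPolynomial.monomial e a)
        = a * f ((fun l => (e l : ℤ)) + Pi.single k 1) := by
      intro k
      rw [MvPolynomial.X, MvPolynomial.monomial_mul, one_mul, monomialSum_monomial]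
      congr 2
      funext l
      simp [Finsupp.single_apply, Pi.single_apply, add_comm, eq_comm]
    rw [sub_mul, map_sub, h, h, monomialSum_monomial]
    ring
  | add p q hp hq => rw [mul_add, map_add, hp, hq, map_add]

/-- Each factor `X i - X j = X i (1 - X j / X i)` cancels one root from the partition function and
leaves the shift by `e i`. After all factors of `s` are used, the empty partition function remains,
which picks out a single coefficient. -/
theorem monomialSum_prod_mul {n : ℕ} (s : Finset (RootPair n)) (β : Fin n → ℤ)
    (g : MvPolynomial (Fin n) ℤ) :
    monomialSum (fun γ => vecCount s rootVec (γ - β))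
      ((∏ p ∈ s, (MvPolynomial.X p.1.1 - MvPolynomial.X p.1.2)) * g)
      = monomialSum (fun γ => vecCount (∅ : Finset (RootPair n)) rootVec
        (γ - (β - ∑ p ∈ s, Pi.single p.1.1 1))) g := by
  classical
  induction s using Finset.induction_on generalizing β with
  | empty => simp
  | insert p s hp ih =>
    rw [Finset.prod_insert hp, Finset.sum_insert hp, mul_assoc, monomialSum_X_sub_X_mul]
    have h : (fun γ : Fin n → ℤ => vecCount (insert p s) rootVec (γ + Pi.single p.1.1 1 - β)
        - vecCount (insert p s) rootVec (γ + Pi.single p.1.2 1 - β))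
        = fun γ => vecCount s rootVec (γ - (β - Pi.single p.1.1 1)) := by
      funext γ
      rw [vecCount_eq_add (rootHeight n) (fun q _ => rootHeight_rootVec_pos q)
        (Finset.mem_insert_self p s), Finset.erase_insert hp]
      have e1 : γ + Pi.single p.1.1 1 - β - rootVec p = γ + Pi.single p.1.2 1 - β := by
        rw [rootVec]; abel
      have e2 : γ + Pi.single p.1.1 1 - β = γ - (β - Pi.single p.1.1 1) := by abel
      rw [e1, add_sub_cancel_right, e2]
    rw [h, ih, sub_sub]

theorem prod_rootPair {n : ℕ} {M : Type*} [CommMonoid M] (F : Fin n → Fin n → M) :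
    ∏ p : RootPair n, F p.1.1 p.1.2 = ∏ i, ∏ j ∈ Finset.Ioi i, F i j := by
  rw [Finset.prod_sigma']
  refine Finset.prod_bij' (fun p _ => ⟨p.1.1, p.1.2⟩)
    (fun q hq => ⟨(q.1, q.2), Finset.mem_Ioi.1 (Finset.mem_sigma.1 hq).2⟩) ?_ ?_ ?_ ?_ ?_
  · intro p _
    simpa using p.2
  · simp
  · simp
  · simp
  · simp

theorem alternant_staircase_eq_prod (n : ℕ) : alternant (staircase n)
    = ∏ p : RootPair n, (MvPolynomial.X p.1.1 - MvPolynomial.X p.1.2) := by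
  have h1 : alternant (staircase n)
      = (Matrix.vandermonde fun i : Fin n => (MvPolynomial.X i.rev : MvPolynomial _ ℤ)).det := by
    unfold alternant
    rw [← Matrix.det_submatrix_equiv_self Fin.revPerm]
    congr 1
    ext1 i j
    simp only [Matrix.submatrix_apply, Matrix.of_apply, Matrix.vandermonde, staircase,
      Fin.revPerm_apply, Fin.rev_rev]
  rw [h1, Matrix.det_vandermonde, ← prod_rootPair fun i j =>
    (MvPolynomial.X j.rev - MvPolynomial.X i.rev : MvPolynomial (Fin n) ℤ)]
  -- The Vandermonde product is ordered by increasing exponents and the staircase by decreasing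
  -- ones; reversing the indices matches the factors.
  let e : RootPair n → RootPair n := fun p => ⟨(p.1.2.rev, p.1.1.rev), Fin.rev_lt_rev.2 p.2⟩
  have he : Function.Involutive e := fun p => by simp [e]
  exact Fintype.prod_equiv he.toPerm _ _ fun p => rfl

theorem sum_single_rootPair (n : ℕ) :
    ∑ p : RootPair n, (Pi.single p.1.1 1 : Fin n → ℤ) = fun i => (staircase n i : ℤ) := by
  have h : ∑ p : RootPair n, (Pi.single p.1.1 1 : Fin n → ℤ)
      = ∑ i, ∑ j ∈ Finset.Ioi i, (Pi.single i 1 : Fin n → ℤ) := by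
    rw [Finset.sum_sigma']
    refine Finset.sum_bij' (fun p _ => ⟨p.1.1, p.1.2⟩)
      (fun q hq => ⟨(q.1, q.2), Finset.mem_Ioi.1 (Finset.mem_sigma.1 hq).2⟩) ?_ ?_ ?_ ?_ ?_
    · intro p _
      simpa using p.2
    · simp
    · simp
    · simp
    · simp
  rw [h]
  funext i
  simp [Pi.single_apply, staircase, Fin.val_rev]
  omega

/-- Pairing with Kostant's partition function inverts multiplication by `a_δ`; the shifts `e i` over
all positive roots add up to `δ`. -/
theorem monomialSum_vecCount_univ {n : ℕ} (d : Fin n →₀ ℕ) (g : MvPolynomial (Fin n) ℤ) :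
    monomialSum (fun γ => vecCount (Finset.univ : Finset (RootPair n)) rootVec
      (γ - fun i => ((d i + staircase n i : ℕ) : ℤ))) (alternant (staircase n) * g)
      = g.coeff d := by
  rw [alternant_staircase_eq_prod, monomialSum_prod_mul, sum_single_rootPair,
    ← monomialSum_vecCount_empty]
  congr 2
  funext γ
  congr 2
  funext i
  simp

/-- The Kostka number is a coefficient of the Schur function. -/
theorem kostkaNumber_eq_coeff {n : ℕ} (lam : PartitionSeq n) (mu : Fin n → ℕ) :
    kostkaNumber lam mu = (schur lam).coeff (Finsupp.equivFunOnFinite.symm mu) := by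
  rw [← monomialSum_vecCount_univ, alternant_mul_schur, monomialSum_alternant]
  unfold kostkaNumber kostkaFoulkes
  rw [Polynomial.eval_finsetSum]
  refine Finset.sum_congr rfl fun w _ => ?_
  rw [zsmul_eq_mul, Polynomial.eval_mul, Polynomial.eval_intCast, eval_one_qKostant]
  rfl

/-- For each `w` the argument of the partition function is `N (w lam - mu) + (w δ - δ)`, a ray. -/
theorem evPoly_kostkaNumber {n : ℕ} (lam : PartitionSeq n) (mu : Fin n → ℕ) :
    EvPoly fun N => (kostkaNumber (lam.dilate N) (fun i => N * mu i) : ℚ) := by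
  have h := EvPoly.sum (Finset.univ : Finset (Equiv.Perm (Fin n))) fun w _ =>
    (evPoly_vecCount_rootVec (Finset.univ : Finset (RootPair n))
      (fun i => (lam.1 (w i) : ℤ) - (mu i : ℤ))
      (fun i => (staircase n (w i) : ℤ) - (staircase n i : ℤ))).const_mul
      ((Equiv.Perm.sign w : ℤˣ) : ℤ)
  refine (congrArg EvPoly (funext fun N => ?_)).mpr h
  unfold kostkaNumber kostkaFoulkes
  rw [Polynomial.eval_finsetSum]
  push_cast
  refine Finset.sum_congr rfl fun w _ => ?_
  rw [zsmul_eq_mul, Polynomial.eval_mul, Polynomial.eval_intCast, eval_one_qKostant]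
  push_cast
  congr 3
  funext i
  simp [PartitionSeq.dilate]
  ring

/-! ### Steinberg's formula -/

/-- Multiplying the Schur expansion by `a_δ` turns it into an expansion in alternants, whose
coefficients are read off at strictly decreasing exponents. -/
theorem lrNumber_eq_coeff {n : ℕ} (lam mu nu : PartitionSeq n) :
    lrNumber lam mu nu = (alternant (mu.1 + staircase n) * schur lam).coeff
      (Finsupp.equivFunOnFinite.symm (nu.1 + staircase n)) := by
  classical
  have h := Classical.choose_spec (existsUnique_schur_mul lam mu).exists
  have h2 : lrNumber lam mu nu = Classical.choose (existsUnique_schur_mul lam mu).exists nu := rfl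
  rw [h2]
  set c := Classical.choose (existsUnique_schur_mul lam mu).exists
  have h3 : alternant (mu.1 + staircase n) * schur lam
      = c.sum fun nu z => z • alternant (nu.1 + staircase n) := by
    rw [← alternant_mul_schur, mul_assoc, mul_comm (schur mu), h]
    simp only [Finsupp.sum, Finset.mul_sum, mul_smul_comm, alternant_mul_schur]
  rw [h3, Finsupp.sum, MvPolynomial.coeff_sum]
  simp only [MvPolynomial.coeff_smul]
  have h4 : ∀ k : PartitionSeq n, (alternant (k.1 + staircase n)).coeff
      (Finsupp.equivFunOnFinite.symm (nu.1 + staircase n)) = if k = nu then 1 else 0 := by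
    intro k
    rw [coeff_alternant (strictAnti_add_staircase k) (strictAnti_add_staircase nu)]
    congr 1
    rw [add_left_inj]
    exact propext Subtype.ext_iff.symm
  simp only [h4, smul_eq_mul, mul_ite, mul_one, mul_zero, Finset.sum_ite_eq']
  split_ifs with h
  · rfl
  · exact Finsupp.notMem_support_iff.1 h

/-- Inserting another `a_δ` to extract the coefficient turns `s_lam` into an alternant as well. This
explains the two sums over permutations and the offset `nu + 2 δ`. -/
theorem lrNumber_eq_sum_sum {n : ℕ} (lam mu nu : PartitionSeq n) :
    lrNumber lam mu nu = ∑ w : Equiv.Perm (Fin n), ((Equiv.Perm.sign w : ℤˣ) : ℤ) *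
      ∑ w' : Equiv.Perm (Fin n), ((Equiv.Perm.sign w' : ℤˣ) : ℤ) *
        vecCount (Finset.univ : Finset (RootPair n)) rootVec (fun i =>
          ((lam.1 (w' i) + staircase n (w' i) : ℕ) : ℤ)
          + ((mu.1 (w i) + staircase n (w i) : ℕ) : ℤ)
          - ((nu.1 i + staircase n i + staircase n i : ℕ) : ℤ)) := by
  rw [lrNumber_eq_coeff, ← monomialSum_vecCount_univ, mul_left_comm, alternant_mul_schur,
    monomialSum_alternant_mul]
  refine Finset.sum_congr rfl fun w _ => ?_
  rw [monomialSum_alternant]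
  rfl

theorem evPoly_lrNumber {n : ℕ} (lam mu nu : PartitionSeq n) :
    EvPoly fun N => (lrNumber (lam.dilate N) (mu.dilate N) (nu.dilate N) : ℚ) := by
  have h := EvPoly.sum (Finset.univ : Finset (Equiv.Perm (Fin n))) fun w _ =>
    (EvPoly.sum (Finset.univ : Finset (Equiv.Perm (Fin n))) fun w' _ =>
    (evPoly_vecCount_rootVec (Finset.univ : Finset (RootPair n))
      (fun i => (lam.1 (w' i) : ℤ) + (mu.1 (w i) : ℤ) - (nu.1 i : ℤ))
      (fun i => (staircase n (w' i) : ℤ) + (staircase n (w i) : ℤ)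
        - 2 * (staircase n i : ℤ))).const_mul
      ((Equiv.Perm.sign w' : ℤˣ) : ℤ)).const_mul ((Equiv.Perm.sign w : ℤˣ) : ℤ)
  refine (congrArg EvPoly (funext fun N => ?_)).mpr h
  rw [lrNumber_eq_sum_sum]
  push_cast
  refine Finset.sum_congr rfl fun w _ => ?_
  congr 1
  refine Finset.sum_congr rfl fun w' _ => ?_
  congr 3
  funext i
  simp [PartitionSeq.dilate]
  ring

/-! ### Gelfand–Tsetlin patterns -/

/-- Gelfand–Tsetlin patterns with `n` rows and top row `lam`: chains of interlacing sequences from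
`x 0 = 0` to `x n = lam`. All rows are extended by zeros, and `x k = lam` for `k ≥ n`. -/
structure IsGT (n : ℕ) (lam : ℕ → ℕ) (x : ℕ → ℕ → ℕ) : Prop where
  zero : ∀ i, x 0 i = 0
  le : ∀ k, k < n → ∀ i, x k i ≤ x (k + 1) i
  ge : ∀ k, k < n → ∀ i, x (k + 1) (i + 1) ≤ x k i
  top : ∀ k, n ≤ k → x k = lam

namespace IsGT

variable {n : ℕ} {lam : ℕ → ℕ} {x : ℕ → ℕ → ℕ}

/-- Interlacing shortens the support by one per row, starting from the zero row. -/
theorem eq_zero (h : IsGT n lam x) {k i : ℕ} (hk : k ≤ n) (hi : k ≤ i) : x k i = 0 := by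
  induction k generalizing i with
  | zero => exact h.zero i
  | succ k ih =>
    obtain ⟨i, rfl⟩ : ∃ i', i = i' + 1 := ⟨i - 1, by omega⟩
    have h1 := h.ge k (by omega) i
    have h2 := ih (by omega) (i := i) (by omega)
    omega

theorem antitone (h : IsGT n lam x) {k : ℕ} (hk : k ≤ n) : Antitone (x k) := by
  refine antitone_nat_of_succ_le fun i => ?_
  cases k with
  | zero => simp [h.zero]
  | succ k => exact (h.ge k (by omega) i).trans (h.le k (by omega) i)

theorem le_top (h : IsGT n lam x) {k : ℕ} (hk : k ≤ n) (i : ℕ) : x k i ≤ lam i := by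
  obtain ⟨m, rfl⟩ := Nat.exists_eq_add_of_le hk
  have key : ∀ j ≤ m, x k i ≤ x (k + j) i := by
    intro j hj
    induction j with
    | zero => exact le_rfl
    | succ j ih => exact (ih (by omega)).trans (h.le (k + j) (by omega) i)
  have := key m le_rfl
  rwa [h.top (k + m) le_rfl] at this

end IsGT

/-- The part of a pattern below the top row. -/
def gtRestrict (n : ℕ) (x : ℕ → ℕ → ℕ) : Fin n × Fin n → ℕ := fun p => x p.1 p.2

theorem gtRestrict_injOn (n : ℕ) (lam : ℕ → ℕ) :
    Set.InjOn (gtRestrict n) {x | IsGT n lam x} := by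
  intro x hx y hy hxy
  funext k i
  by_cases hk : k < n
  · by_cases hi : i < n
    · exact congrFun hxy (⟨k, hk⟩, ⟨i, hi⟩)
    · rw [IsGT.eq_zero hx hk.le (by omega), IsGT.eq_zero hy hk.le (by omega)]
  · rw [hx.top k (by omega), hy.top k (by omega)]

theorem isGT_finite (n : ℕ) (lam : ℕ → ℕ) : {x | IsGT n lam x}.Finite := by
  refine Set.Finite.of_finite_image (f := gtRestrict n)
    ((Set.finite_Iic fun p : Fin n × Fin n => lam p.2).subset ?_) (gtRestrict_injOn n lam)
  rintro _ ⟨x, hx, rfl⟩ p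
  exact IsGT.le_top hx p.1.2.le p.2

/-- The finite set of all patterns with top row `lam`. -/
noncomputable def gtPatterns (n : ℕ) (lam : ℕ → ℕ) : Finset (ℕ → ℕ → ℕ) :=
  (isGT_finite n lam).toFinset

theorem mem_gtPatterns {n : ℕ} {lam : ℕ → ℕ} {x : ℕ → ℕ → ℕ} :
    x ∈ gtPatterns n lam ↔ IsGT n lam x := by
  simp [gtPatterns]

/-- The weight of a pattern: the differences of consecutive row sums. -/
def gtWeight (n : ℕ) (x : ℕ → ℕ → ℕ) : Fin n → ℕ := fun j =>
  ∑ i ∈ Finset.range n, x (j + 1) i - ∑ i ∈ Finset.range n, x j i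

theorem IsGT.gtWeight_cast {n : ℕ} {lam : ℕ → ℕ} {x : ℕ → ℕ → ℕ} (h : IsGT n lam x) (j : Fin n) :
    (gtWeight n x j : ℤ)
      = ∑ i ∈ Finset.range n, (x (j + 1) i : ℤ) - ∑ i ∈ Finset.range n, (x j i : ℤ) := by
  unfold gtWeight
  rw [Nat.cast_sub (Finset.sum_le_sum fun i _ => h.le j j.2 i)]
  push_cast
  rfl

/-- The number of entries of the tableau of shape `x k` beyond column `c`. -/
def rowExcess (n : ℕ) (x : ℕ → ℕ → ℕ) (k c : ℕ) : ℤ :=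
  ∑ i ∈ Finset.range n, ((x k i - c : ℕ) : ℤ)

/-- The difference of the parts `j` and `j + 1` of `mu` plus the weight of the columns beyond `c`
of the tableau of the pattern `x`. -/
def gtDefect (n : ℕ) (mu : ℕ → ℕ) (x : ℕ → ℕ → ℕ) (j c : ℕ) : ℤ :=
  (mu j : ℤ) - mu (j + 1) + 2 * rowExcess n x (j + 1) c - rowExcess n x j c
    - rowExcess n x (j + 2) c

/-! ### Toggling a row of a pattern -/

/-- The lower bound for the entry `i` of row `j + 1`. -/
def gtLow (x : ℕ → ℕ → ℕ) (j i : ℕ) : ℕ := max (x (j + 2) (i + 1)) (x j i)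

/-- The upper bound for the entry `i` of row `j + 1`. -/
def gtHigh (x : ℕ → ℕ → ℕ) (j : ℕ) : ℕ → ℕ
  | 0 => x (j + 2) 0
  | i + 1 => min (x (j + 2) (i + 1)) (x j i)

/-- The Bender–Knuth involution on row `j + 1`, applied to the first `c` columns only. -/
def gtToggle (j c : ℕ) (x : ℕ → ℕ → ℕ) : ℕ → ℕ → ℕ :=
  Function.update x (j + 1) fun i =>
    x (j + 1) i - c + min (gtLow x j i) c + min (gtHigh x j i) c - min (x (j + 1) i) c

/-- Row `j + 1` of `x` may be cut after column `c`. -/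
def GTCut (j c : ℕ) (x : ℕ → ℕ → ℕ) : Prop := ∀ i, c < x (j + 1) i → c ≤ gtLow x j i

section Toggle

variable {n : ℕ} {lam : ℕ → ℕ} {x : ℕ → ℕ → ℕ} {j c : ℕ}

theorem IsGT.low_le (h : IsGT n lam x) (hj : j + 1 < n) (i : ℕ) : gtLow x j i ≤ x (j + 1) i :=
  max_le (h.ge (j + 1) hj i) (h.le j (by omega) i)

theorem IsGT.le_high (h : IsGT n lam x) (hj : j + 1 < n) (i : ℕ) : x (j + 1) i ≤ gtHigh x j i := by
  cases i with
  | zero => exact h.le (j + 1) hj 0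
  | succ i => exact le_min (h.le (j + 1) hj (i + 1)) (h.ge j (by omega) i)

theorem gtToggle_row (i : ℕ) : gtToggle j c x (j + 1) i =
    x (j + 1) i - c + min (gtLow x j i) c + min (gtHigh x j i) c - min (x (j + 1) i) c := by
  simp [gtToggle]

theorem gtToggle_of_ne {k : ℕ} (hk : k ≠ j + 1) : gtToggle j c x k = x k := by
  simp [gtToggle, hk]

theorem gtLow_gtToggle (i : ℕ) : gtLow (gtToggle j c x) j i = gtLow x j i := by
  unfold gtLow
  rw [gtToggle_of_ne (by omega), gtToggle_of_ne (by omega)]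

theorem gtHigh_gtToggle (i : ℕ) : gtHigh (gtToggle j c x) j i = gtHigh x j i := by
  cases i <;>
  · unfold gtHigh
    simp only [gtToggle_of_ne (show j + 2 ≠ j + 1 by omega),
      gtToggle_of_ne (show j ≠ j + 1 by omega)]

/-- Under the cut condition an entry larger than `c` does not move, while an entry at most `c` is
reflected in the interval from its lower bound to the minimum of its upper bound and `c`. -/
theorem IsGT.low_le_gtToggle (h : IsGT n lam x) (hj : j + 1 < n) (hc : GTCut j c x) (i : ℕ) :
    gtLow x j i ≤ gtToggle j c x (j + 1) i := by
  have h1 := h.low_le hj i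
  have h2 := h.le_high hj i
  have h3 := hc i
  rw [gtToggle_row]
  omega

theorem IsGT.gtToggle_le_high (h : IsGT n lam x) (hj : j + 1 < n) (hc : GTCut j c x) (i : ℕ) :
    gtToggle j c x (j + 1) i ≤ gtHigh x j i := by
  have h1 := h.low_le hj i
  have h2 := h.le_high hj i
  have h3 := hc i
  rw [gtToggle_row]
  omega

/-- The columns beyond `c` are untouched; all defects at or to the right of the cut are therefore
preserved. -/
theorem IsGT.gtToggle_tsub (h : IsGT n lam x) (hj : j + 1 < n) (hc : GTCut j c x) {d : ℕ}
    (hd : c ≤ d) (i : ℕ) : gtToggle j c x (j + 1) i - d = x (j + 1) i - d := by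
  have h1 := h.low_le hj i
  have h2 := h.le_high hj i
  have h3 := hc i
  rw [gtToggle_row]
  omega

theorem IsGT.gtToggle_add (h : IsGT n lam x) (hj : j + 1 < n) (i : ℕ) :
    gtToggle j c x (j + 1) i + x (j + 1) i
      = 2 * (x (j + 1) i - c) + min (gtLow x j i) c + min (gtHigh x j i) c := by
  have h1 := h.low_le hj i
  have h2 := h.le_high hj i
  rw [gtToggle_row]
  omega

theorem IsGT.isGT_gtToggle (h : IsGT n lam x) (hj : j + 1 < n) (hc : GTCut j c x) :
    IsGT n lam (gtToggle j c x) := by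
  have hlow := h.low_le_gtToggle hj hc
  have hhigh := h.gtToggle_le_high hj hc
  refine ⟨fun i => ?_, fun k hk i => ?_, fun k hk i => ?_, fun k hk => ?_⟩
  · rw [gtToggle_of_ne (by omega)]
    exact h.zero i
  · by_cases h1 : k = j + 1
    · subst h1
      rw [gtToggle_of_ne (k := j + 1 + 1) (by omega)]
      refine (hhigh i).trans ?_
      cases i with
      | zero => exact le_rfl
      | succ i => exact min_le_left _ _
    · rw [gtToggle_of_ne h1]
      by_cases h2 : k = j
      · subst h2
        exact (le_max_right _ _).trans (hlow i)
      · rw [gtToggle_of_ne (by omega)]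
        exact h.le k hk i
  · by_cases h1 : k = j + 1
    · subst h1
      rw [gtToggle_of_ne (k := j + 1 + 1) (by omega)]
      exact (le_max_left _ _).trans (hlow i)
    · rw [gtToggle_of_ne h1]
      by_cases h2 : k = j
      · subst h2
        exact (hhigh (i + 1)).trans (min_le_right _ _)
      · rw [gtToggle_of_ne (by omega)]
        exact h.ge k hk i
  · rw [gtToggle_of_ne (by omega)]
    exact h.top k hk

theorem IsGT.gtToggle_gtToggle (h : IsGT n lam x) (hj : j + 1 < n) (hc : GTCut j c x) :
    gtToggle j c (gtToggle j c x) = x := by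
  funext k i
  by_cases hk : k = j + 1
  · subst hk
    have h1 := (h.isGT_gtToggle hj hc).gtToggle_add (c := c) hj i
    have h2 := h.gtToggle_add (c := c) hj i
    rw [gtLow_gtToggle, gtHigh_gtToggle, h.gtToggle_tsub hj hc le_rfl] at h1
    omega
  · rw [gtToggle_of_ne hk, gtToggle_of_ne hk]

theorem IsGT.rowExcess_gtToggle (h : IsGT n lam x) (hj : j + 1 < n) (hc : GTCut j c x) {d : ℕ}
    (hd : c ≤ d) (k : ℕ) : rowExcess n (gtToggle j c x) k d = rowExcess n x k d := by
  unfold rowExcess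
  by_cases hk : k = j + 1
  · subst hk
    exact Finset.sum_congr rfl fun i _ => by rw [h.gtToggle_tsub hj hc hd]
  · rw [gtToggle_of_ne hk]

theorem IsGT.gtDefect_gtToggle (h : IsGT n lam x) (hj : j + 1 < n) (hc : GTCut j c x) {d : ℕ}
    (hd : c ≤ d) (mu : ℕ → ℕ) (k : ℕ) :
    gtDefect n mu (gtToggle j c x) k d = gtDefect n mu x k d := by
  unfold gtDefect
  simp only [h.rowExcess_gtToggle hj hc hd]

/-- The lower bound of entry `i` and the upper bound of entry `i + 1` are the maximum and the
minimum of the same two neighbours, so the sum telescopes into the adjacent rows. The remaining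
upper bound is the first entry of row `j + 2`; the last lower bound is zero. -/
theorem IsGT.sum_low_add_high (h : IsGT n lam x) (hj : j + 1 < n) (c : ℕ) :
    ∑ i ∈ Finset.range n, (min (gtLow x j i) c + min (gtHigh x j i) c)
      = ∑ i ∈ Finset.range n, min (x (j + 2) i) c + ∑ i ∈ Finset.range n, min (x j i) c := by
  obtain ⟨m, rfl⟩ : ∃ m, n = m + 1 := ⟨n - 1, by omega⟩
  rw [Finset.sum_add_distrib, Finset.sum_range_succ, Finset.sum_range_succ' fun i =>
    min (gtHigh x j i) c, Finset.sum_range_succ' fun i => min (x (j + 2) i) c,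
    Finset.sum_range_succ fun i => min (x j i) c]
  have h1 : gtLow x j m = 0 := by
    have h2 := h.low_le hj m
    have h3 := h.eq_zero (k := j + 1) (i := m) (by omega) (by omega)
    omega
  have h4 : x j m = 0 := h.eq_zero (by omega) (by omega)
  have h5 : ∑ i ∈ Finset.range m, min (gtLow x j i) c
      + ∑ i ∈ Finset.range m, min (gtHigh x j (i + 1)) c
      = ∑ i ∈ Finset.range m, min (x (j + 2) (i + 1)) c + ∑ i ∈ Finset.range m, min (x j i) c := by
    rw [← Finset.sum_add_distrib, ← Finset.sum_add_distrib]
    refine Finset.sum_congr rfl fun i _ => ?_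
    simp only [gtLow, gtHigh]
    omega
  rw [h1, h4]
  simp only [gtHigh] at h5 ⊢
  omega

/-- The effect of a toggle on the row sums. -/
theorem IsGT.sum_gtToggle (h : IsGT n lam x) (hj : j + 1 < n) :
    ∑ i ∈ Finset.range n, (gtToggle j c x (j + 1) i : ℤ) + ∑ i ∈ Finset.range n, (x (j + 1) i : ℤ)
      = ∑ i ∈ Finset.range n, (x j i : ℤ) + ∑ i ∈ Finset.range n, (x (j + 2) i : ℤ)
        + 2 * rowExcess n x (j + 1) c - rowExcess n x j c - rowExcess n x (j + 2) c := by
  have h1 : ∑ i ∈ Finset.range n, (gtToggle j c x (j + 1) i : ℤ)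
      + ∑ i ∈ Finset.range n, (x (j + 1) i : ℤ)
      = 2 * rowExcess n x (j + 1) c
        + ((∑ i ∈ Finset.range n, (min (gtLow x j i) c + min (gtHigh x j i) c) : ℕ) : ℤ) := by
    unfold rowExcess
    push_cast
    rw [← Finset.sum_add_distrib, Finset.mul_sum, ← Finset.sum_add_distrib]
    refine Finset.sum_congr rfl fun i _ => ?_
    have := h.gtToggle_add (c := c) hj i
    zify at this
    linarith
  have h2 : ∀ k, ∑ i ∈ Finset.range n, (x k i : ℤ)
      = rowExcess n x k c + ((∑ i ∈ Finset.range n, min (x k i) c : ℕ) : ℤ) := by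
    intro k
    unfold rowExcess
    rw [Nat.cast_sum, ← Finset.sum_add_distrib]
    refine Finset.sum_congr rfl fun i _ => ?_
    omega
  rw [h1, h.sum_low_add_high hj, h2 j, h2 (j + 2)]
  push_cast
  ring

/-- If a toggle moves the row sum suitably, it swaps two entries of `mu + weight + δ`. -/
theorem IsGT.gtWeight_gtToggle (h : IsGT n lam x) (hj : j + 1 < n) (hc : GTCut j c x)
    (α : Fin n → ℕ)
    (hα : (α ⟨j, by omega⟩ : ℤ) - α ⟨j + 1, hj⟩ + 2 * rowExcess n x (j + 1) c
      - rowExcess n x j c - rowExcess n x (j + 2) c = 0) :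
    α + gtWeight n (gtToggle j c x)
      = (α + gtWeight n x) ∘ Equiv.swap (⟨j, by omega⟩ : Fin n) ⟨j + 1, hj⟩ := by
  have hs := h.sum_gtToggle (c := c) hj
  have hx := fun k => h.gtWeight_cast k
  have hy := fun k => (h.isGT_gtToggle hj hc).gtWeight_cast k
  funext k
  simp only [Function.comp_apply, Pi.add_apply]
  zify
  by_cases h1 : (k : ℕ) = j
  · have hk : k = ⟨j, by omega⟩ := Fin.ext h1
    rw [hk, Equiv.swap_apply_left, hy, hx]
    simp only [gtToggle_of_ne (show j ≠ j + 1 by omega)]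
    linarith
  · by_cases h2 : (k : ℕ) = j + 1
    · have hk : k = ⟨j + 1, hj⟩ := Fin.ext h2
      rw [hk, Equiv.swap_apply_right, hy, hx]
      simp only [gtToggle_of_ne (show j + 1 + 1 ≠ j + 1 by omega)]
      linarith
    · rw [Equiv.swap_apply_of_ne_of_ne (fun h => h1 (by rw [h])) (fun h => h2 (by rw [h])), hy, hx,
        gtToggle_of_ne (k := (k : ℕ) + 1) (by omega), gtToggle_of_ne (k := (k : ℕ)) h2]

end Toggle

/-! ### The sign-reversing involution -/

theorem alternant_comp_swap {n : ℕ} (α : Fin n → ℕ) {i j : Fin n} (hij : i ≠ j) :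
    alternant (α ∘ Equiv.swap i j) = -alternant α := by
  have h := Matrix.det_permute' (Equiv.swap i j)
    (Matrix.of fun i j => (MvPolynomial.X i : MvPolynomial (Fin n) ℤ) ^ α j)
  rw [Equiv.Perm.sign_swap hij] at h
  unfold alternant
  refine Eq.trans ?_ (h.trans (by simp))
  rfl

/-- The generating function of the patterns with top row `lam`. -/
noncomputable def gtSum (n : ℕ) (lam : ℕ → ℕ) : MvPolynomial (Fin n) ℤ :=
  ∑ x ∈ gtPatterns n lam, MvPolynomial.monomial (Finsupp.equivFunOnFinite.symm (gtWeight n x)) 1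

/-- A cut to the right of all entries makes the toggle the full Bender–Knuth involution, which
exchanges two adjacent weights. -/
theorem sum_gtPatterns_comp_swap {n : ℕ} (lam : ℕ → ℕ) {j : ℕ} (hj : j + 1 < n)
    {M : Type*} [AddCommMonoid M] (F : (Fin n → ℕ) → M) :
    ∑ x ∈ gtPatterns n lam, F (gtWeight n x ∘ Equiv.swap (⟨j, by omega⟩ : Fin n) ⟨j + 1, hj⟩)
      = ∑ x ∈ gtPatterns n lam, F (gtWeight n x) := by
  obtain ⟨c, hc⟩ : ∃ c : ℕ, ∀ x, IsGT n lam x → ∀ k ≤ n, ∀ i, x k i ≤ c := by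
    by_cases hL : ∃ x, IsGT n lam x
    · obtain ⟨x, hx⟩ := hL
      refine ⟨lam 0, fun y hy k hk i => ?_⟩
      exact (hy.antitone hk (Nat.zero_le i)).trans (hy.le_top hk 0)
    · push Not at hL
      exact ⟨0, fun x hx => absurd hx (hL x)⟩
  have hcut : ∀ x, IsGT n lam x → GTCut j c x := fun x hx i hi =>
    absurd (hc x hx (j + 1) hj.le i) (by omega)
  have hex : ∀ x, IsGT n lam x → ∀ k ≤ n, rowExcess n x k c = 0 := fun x hx k hk =>
    Finset.sum_eq_zero fun i _ => by
      have := hc x hx k hk i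
      omega
  refine Finset.sum_bij' (fun x _ => gtToggle j c x) (fun x _ => gtToggle j c x) ?_ ?_ ?_ ?_ ?_
  · intro x hx
    rw [mem_gtPatterns] at hx ⊢
    exact hx.isGT_gtToggle hj (hcut x hx)
  · intro x hx
    rw [mem_gtPatterns] at hx ⊢
    exact hx.isGT_gtToggle hj (hcut x hx)
  · intro x hx
    rw [mem_gtPatterns] at hx
    exact hx.gtToggle_gtToggle hj (hcut x hx)
  · intro x hx
    rw [mem_gtPatterns] at hx
    exact hx.gtToggle_gtToggle hj (hcut x hx)
  · intro x hx
    rw [mem_gtPatterns] at hx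
    have h := hx.gtWeight_gtToggle hj (hcut x hx) 0 (by
      rw [hex x hx _ hj.le, hex x hx _ (by omega), hex x hx _ (by omega)]
      simp)
    rw [zero_add, zero_add] at h
    rw [h]

theorem sum_gtPatterns_comp_perm {n : ℕ} (lam : ℕ → ℕ) {M : Type*} [AddCommMonoid M]
    (w : Equiv.Perm (Fin n)) (F : (Fin n → ℕ) → M) :
    ∑ x ∈ gtPatterns n lam, F (gtWeight n x ∘ w) = ∑ x ∈ gtPatterns n lam, F (gtWeight n x) := by
  cases n with
  | zero =>
    refine Finset.sum_congr rfl fun x _ => ?_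
    congr 1
  | succ m =>
    have hw : w ∈ Submonoid.closure (Set.range fun i : Fin m => Equiv.swap i.castSucc i.succ) := by
      rw [Equiv.Perm.mclosure_swap_castSucc_succ]
      exact Submonoid.mem_top w
    induction hw using Submonoid.closure_induction generalizing F with
    | mem w hw =>
      obtain ⟨i, rfl⟩ := hw
      exact sum_gtPatterns_comp_swap lam (j := i) (by omega) F
    | one => rfl
    | mul a b _ _ ha hb =>
      have h1 := hb fun f => F f
      have h2 := ha fun f => F (f ∘ b)
      exact h2.trans h1

/-- Symmetry of the weights allows each term `x ^ (w α)` of the alternant to be multiplied by the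
generating function permuted by the same `w`. -/
theorem alternant_mul_gtSum {n : ℕ} (lam : ℕ → ℕ) (α : Fin n → ℕ) :
    alternant α * gtSum n lam = ∑ x ∈ gtPatterns n lam, alternant (α + gtWeight n x) := by
  simp only [alternant_eq_sum (α + _)]
  rw [alternant_eq_sum, Finset.sum_mul, Finset.sum_comm]
  refine Finset.sum_congr rfl fun w _ => ?_
  rw [← Finset.smul_sum, smul_mul_assoc]
  congr 1
  unfold gtSum
  rw [← sum_gtPatterns_comp_perm lam w fun f =>
    MvPolynomial.monomial (Finsupp.equivFunOnFinite.symm f) (1 : ℤ), Finset.mul_sum]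
  refine Finset.sum_congr rfl fun x _ => ?_
  rw [MvPolynomial.monomial_mul, one_mul]
  have h : Finsupp.equivFunOnFinite.symm (α ∘ w)
      + Finsupp.equivFunOnFinite.symm (gtWeight n x ∘ w)
      = Finsupp.equivFunOnFinite.symm ((α + gtWeight n x) ∘ w) := by
    ext i
    rfl
  rw [h]

/-- The weight of every set of columns of the pattern at the right hand side, added to `mu`, is
dominant. -/
def IsGood (n : ℕ) (mu : ℕ → ℕ) (x : ℕ → ℕ → ℕ) : Prop :=
  ∀ c j, j + 1 < n → 0 ≤ gtDefect n mu x j c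

/-- The extension of a finite sequence by zeros. -/
def extendZero {n : ℕ} (f : Fin n → ℕ) : ℕ → ℕ := fun i => if h : i < n then f ⟨i, h⟩ else 0

theorem extendZero_of_lt {n : ℕ} (f : Fin n → ℕ) {i : ℕ} (h : i < n) :
    extendZero f i = f ⟨i, h⟩ := by
  simp [extendZero, h]

theorem extendZero_val {n : ℕ} (f : Fin n → ℕ) (i : Fin n) : extendZero f i = f i :=
  extendZero_of_lt f i.2

theorem extendZero_of_le {n : ℕ} (f : Fin n → ℕ) {i : ℕ} (h : n ≤ i) : extendZero f i = 0 := by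
  simp [extendZero, not_lt.2 h]

theorem extendZero_antitone {n : ℕ} {f : Fin n → ℕ} (hf : Antitone f) :
    Antitone (extendZero f) := by
  intro i j hij
  by_cases hj : j < n
  · rw [extendZero_of_lt f hj, extendZero_of_lt f (hij.trans_lt hj)]
    exact hf hij
  · rw [extendZero_of_le f (not_lt.1 hj)]
    exact Nat.zero_le _

/-- `(c, j)` is the first place, from the right, where a pattern fails to be good. -/
def IsFirstBad (n : ℕ) (mu : ℕ → ℕ) (x : ℕ → ℕ → ℕ) (p : ℕ × ℕ) : Prop :=
  p.2 + 1 < n ∧ gtDefect n mu x p.2 p.1 < 0 ∧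
    (∀ c j, p.1 < c → j + 1 < n → 0 ≤ gtDefect n mu x j c) ∧
    ∀ j, j < p.2 → 0 ≤ gtDefect n mu x j p.1

theorem IsFirstBad.unique {n : ℕ} {mu : ℕ → ℕ} {x : ℕ → ℕ → ℕ} {p q : ℕ × ℕ}
    (hp : IsFirstBad n mu x p) (hq : IsFirstBad n mu x q) : p = q := by
  obtain ⟨c, j⟩ := p
  obtain ⟨d, k⟩ := q
  obtain ⟨p1, p2, p3, p4⟩ := hp
  obtain ⟨q1, q2, q3, q4⟩ := hq
  simp only at *
  have hcd : c = d := by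
    rcases lt_trichotomy c d with h | h | h
    · exact absurd (p3 d k h q1) (not_le.2 q2)
    · exact h
    · exact absurd (q3 c j h p1) (not_le.2 p2)
  subst hcd
  have hjk : j = k := by
    rcases lt_trichotomy j k with h | h | h
    · exact absurd (q4 j h) (not_le.2 p2)
    · exact h
    · exact absurd (p4 k h) (not_le.2 q2)
  rw [hjk]

section Involution

variable {n : ℕ} {lam mu : ℕ → ℕ} {x : ℕ → ℕ → ℕ}

/-- Beyond column `lam 0` the defects are differences of parts of `mu`, hence non-negative. A
rightmost bad cut therefore exists, and the least row is taken at that cut. -/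
theorem IsGT.exists_isFirstBad (h : IsGT n lam x) (hmu : Antitone mu) (hbad : ¬IsGood n mu x) :
    ∃ p, IsFirstBad n mu x p := by
  classical
  have hbound : ∀ c j, lam 0 ≤ c → j + 1 < n → 0 ≤ gtDefect n mu x j c := by
    intro c j hc hj
    have hz : ∀ k ≤ n, rowExcess n x k c = 0 := fun k hk =>
      Finset.sum_eq_zero fun i _ => by
        have := (h.antitone hk (Nat.zero_le i)).trans (h.le_top hk 0)
        omega
    unfold gtDefect
    rw [hz _ hj.le, hz _ (by omega), hz _ (by omega)]
    have := hmu (Nat.le_succ j)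
    simp only [Nat.succ_eq_add_one] at this
    omega
  unfold IsGood at hbad
  push Not at hbad
  obtain ⟨c₀, hc₀⟩ := hbad
  let P : ℕ → Prop := fun c => ∃ j, j + 1 < n ∧ gtDefect n mu x j c < 0
  have hP₀ : P c₀ := hc₀
  have hlt : ∀ c, P c → c ≤ lam 0 := by
    rintro c ⟨j, hj, hjc⟩
    by_contra hlt
    exact absurd (hbound c j (by omega) hj) (not_le.2 hjc)
  have hPc : P (Nat.findGreatest P (lam 0)) := Nat.findGreatest_spec (hlt c₀ hP₀) hP₀
  refine ⟨(Nat.findGreatest P (lam 0), Nat.find hPc), (Nat.find_spec hPc).1,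
    (Nat.find_spec hPc).2, fun c j hc hj => ?_, fun j hj => ?_⟩
  · by_contra hneg
    have hPc' : P c := ⟨j, hj, not_le.1 hneg⟩
    exact Nat.findGreatest_is_greatest hc (hlt c hPc') hPc'
  · by_contra hneg
    have h1 : (Nat.find hPc) + 1 < n := (Nat.find_spec hPc).1
    exact Nat.find_min hPc hj ⟨lt_trans (by simpa using hj) h1, not_le.1 hneg⟩

theorem rowExcess_sub_succ (n : ℕ) (x : ℕ → ℕ → ℕ) (k c : ℕ) :
    rowExcess n x k c - rowExcess n x k (c + 1)
      = (((Finset.range n).filter fun i => c < x k i).card : ℤ) := by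
  unfold rowExcess
  rw [← Finset.sum_sub_distrib, Finset.card_filter, Nat.cast_sum]
  refine Finset.sum_congr rfl fun i _ => ?_
  split_ifs <;> push_cast <;> omega

/-- One column contains each letter at most once, so adding it lowers the defect by at most 1; the
first negative value is exactly `-1`. The drop is attained only if rows `j` and `j + 1` have equally
many entries greater than `c`, which is what makes the cut admissible. -/
theorem IsGT.gtDefect_isFirstBad (h : IsGT n lam x) {c j : ℕ}
    (hbad : IsFirstBad n mu x (c, j)) : gtDefect n mu x j c = -1 ∧ GTCut j c x := by
  obtain ⟨hj, h1, h2, -⟩ := hbad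
  have h3 := h2 (c + 1) j (by simp) hj
  simp only at hj h1
  have e0 := rowExcess_sub_succ n x j c
  have e1 := rowExcess_sub_succ n x (j + 1) c
  have e2 := rowExcess_sub_succ n x (j + 2) c
  have s0 : ((Finset.range n).filter fun i => c < x j i)
      ⊆ (Finset.range n).filter fun i => c < x (j + 1) i := fun i hi => by
    obtain ⟨hi1, hi2⟩ := Finset.mem_filter.1 hi
    exact Finset.mem_filter.2 ⟨hi1, hi2.trans_le (h.le j (by omega) i)⟩
  have s2 : ((Finset.range n).filter fun i => c < x (j + 2) i)
      ⊆ insert 0 (((Finset.range n).filter fun i => c < x (j + 1) i).image (· + 1)) := by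
    intro i hi
    obtain ⟨hi1, hi2⟩ := Finset.mem_filter.1 hi
    cases i with
    | zero => exact Finset.mem_insert_self _ _
    | succ i =>
      refine Finset.mem_insert_of_mem (Finset.mem_image.2 ⟨i, Finset.mem_filter.2 ⟨?_, ?_⟩, rfl⟩)
      · rw [Finset.mem_range] at hi1 ⊢
        omega
      · exact hi2.trans_le (h.ge (j + 1) hj i)
  have c0 := Finset.card_le_card s0
  have c2 : ((Finset.range n).filter fun i => c < x (j + 2) i).card
      ≤ ((Finset.range n).filter fun i => c < x (j + 1) i).card + 1 :=
    (Finset.card_le_card s2).trans ((Finset.card_insert_le _ _).trans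
      (Nat.add_le_add_right Finset.card_image_le 1))
  unfold gtDefect at h1 h3 ⊢
  have hcard : ((Finset.range n).filter fun i => c < x j i).card
      = ((Finset.range n).filter fun i => c < x (j + 1) i).card := by
    omega
  refine ⟨?_, fun i hi => ?_⟩
  · omega
  · have hin : i < n := by
      by_contra hin
      rw [h.eq_zero hj.le (by omega)] at hi
      omega
    have hmem : i ∈ (Finset.range n).filter fun i => c < x (j + 1) i :=
      Finset.mem_filter.2 ⟨Finset.mem_range.2 hin, hi⟩
    rw [← Finset.eq_of_subset_of_card_le s0 hcard.ge] at hmem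
    exact (Finset.mem_filter.1 hmem).2.le.trans (le_max_right _ _)

open Classical in
/-- The first bad place of a pattern. -/
noncomputable def firstBad (n : ℕ) (mu : ℕ → ℕ) (x : ℕ → ℕ → ℕ) : ℕ × ℕ :=
  if h : ∃ p, IsFirstBad n mu x p then h.choose else (0, 0)

theorem IsFirstBad.firstBad_eq {p : ℕ × ℕ} (h : IsFirstBad n mu x p) : firstBad n mu x = p := by
  have hex : ∃ p, IsFirstBad n mu x p := ⟨p, h⟩
  rw [firstBad, dif_pos hex]
  exact hex.choose_spec.unique h

/-- The sign-reversing involution on patterns that are not good. -/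
noncomputable def badToggle (n : ℕ) (mu : ℕ → ℕ) (x : ℕ → ℕ → ℕ) : ℕ → ℕ → ℕ :=
  gtToggle (firstBad n mu x).2 (firstBad n mu x).1 x

/-- The first bad place depends only on columns beyond the cut, and the toggle does not change
these. Hence the toggle of bad patterns is an involution. -/
theorem IsGT.isFirstBad_badToggle (h : IsGT n lam x) {p : ℕ × ℕ} (hp : IsFirstBad n mu x p) :
    IsFirstBad n mu (badToggle n mu x) p := by
  obtain ⟨c, j⟩ := p
  have hcut := (h.gtDefect_isFirstBad hp).2
  rw [badToggle, hp.firstBad_eq]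
  obtain ⟨hj, h1, h2, h3⟩ := hp
  simp only at hj h1 h2 h3 ⊢
  refine ⟨hj, ?_, fun d k hd hk => ?_, fun k hk => ?_⟩
  · rw [h.gtDefect_gtToggle hj hcut le_rfl]
    exact h1
  · rw [h.gtDefect_gtToggle hj hcut (le_of_lt hd)]
    exact h2 d k hd hk
  · rw [h.gtDefect_gtToggle hj hcut le_rfl]
    exact h3 k hk

end Involution

/-- The cancellation of the bad patterns in `a_{mu + δ} s_lam`. -/
theorem alternant_mul_gtSum_eq_sum_good {n : ℕ} (lam : ℕ → ℕ) {mu : Fin n → ℕ}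
    (hmu : Antitone mu) [DecidablePred (IsGood n (extendZero mu))] :
    alternant (mu + staircase n) * gtSum n lam
      = ∑ x ∈ (gtPatterns n lam).filter (IsGood n (extendZero mu)),
        alternant (mu + staircase n + gtWeight n x) := by
  rw [alternant_mul_gtSum, ← Finset.sum_filter_add_sum_filter_not _
    (IsGood n (extendZero mu)), add_eq_left]
  have hmem : ∀ x, x ∈ (gtPatterns n lam).filter (fun x => ¬IsGood n (extendZero mu) x) ↔
      IsGT n lam x ∧ ¬IsGood n (extendZero mu) x := fun x => by
    rw [Finset.mem_filter, mem_gtPatterns]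
  have hneg : ∀ x, IsGT n lam x → ¬IsGood n (extendZero mu) x →
      alternant (mu + staircase n + gtWeight n (badToggle n (extendZero mu) x))
        = -alternant (mu + staircase n + gtWeight n x) := by
    intro x hx hbad
    obtain ⟨⟨c, j⟩, hp⟩ := hx.exists_isFirstBad (extendZero_antitone hmu) hbad
    obtain ⟨hdef, hcut⟩ := hx.gtDefect_isFirstBad hp
    have hj : j + 1 < n := hp.1
    rw [badToggle, hp.firstBad_eq, hx.gtWeight_gtToggle hj hcut, alternant_comp_swap]
    · intro h
      have := congrArg Fin.val h
      simp at this
    -- The parts of `δ` differ by 1, cancelling the defect `-1`; the two entries of `mu + δ +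
    -- weight` are then exchanged and the alternant changes sign.
    · unfold gtDefect at hdef
      rw [extendZero_of_lt mu hj, extendZero_of_lt mu (by omega)] at hdef
      simp only [Pi.add_apply, staircase, Fin.val_rev]
      push_cast [Nat.cast_sub (show j + 1 ≤ n by omega), Nat.cast_sub (show j + 1 + 1 ≤ n by omega)]
      linarith
  refine Finset.sum_involution (fun x _ => badToggle n (extendZero mu) x) ?_ ?_ ?_ ?_
  · intro x hx
    obtain ⟨h1, h2⟩ := (hmem x).1 hx
    rw [hneg x h1 h2, add_neg_cancel]
  · intro x hx hne heq
    obtain ⟨h1, h2⟩ := (hmem x).1 hx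
    have h3 := hneg x h1 h2
    rw [heq] at h3
    -- A fixed pattern contributes an alternant equal to its own negative, hence zero.
    exact hne (self_eq_neg.1 h3)
  · intro x hx
    obtain ⟨h1, h2⟩ := (hmem x).1 hx
    obtain ⟨⟨c, j⟩, hp⟩ := h1.exists_isFirstBad (extendZero_antitone hmu) h2
    have hp' := h1.isFirstBad_badToggle hp
    refine (hmem _).2 ⟨?_, fun hgood => absurd (hgood c j hp'.1) (not_le.2 hp'.2.1)⟩
    rw [badToggle, hp.firstBad_eq]
    exact h1.isGT_gtToggle hp.1 (h1.gtDefect_isFirstBad hp).2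
  · intro x hx
    obtain ⟨h1, h2⟩ := (hmem x).1 hx
    obtain ⟨⟨c, j⟩, hp⟩ := h1.exists_isFirstBad (extendZero_antitone hmu) h2
    have hp' := h1.isFirstBad_badToggle hp
    rw [badToggle, hp'.firstBad_eq, badToggle, hp.firstBad_eq]
    exact h1.gtToggle_gtToggle hp.1 (h1.gtDefect_isFirstBad hp).2

/-! ### Good patterns -/

theorem antitone_fin_of_succ_le {n : ℕ} {f : Fin n → ℕ}
    (h : ∀ j (hj : j + 1 < n), f ⟨j + 1, hj⟩ ≤ f ⟨j, by omega⟩) : Antitone f := by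
  cases n with
  | zero => exact fun i => i.elim0
  | succ m => exact Fin.antitone_iff_succ_le.2 fun i => h i (by omega)

theorem rowExcess_zero (n : ℕ) (x : ℕ → ℕ → ℕ) (k : ℕ) :
    rowExcess n x k 0 = ∑ i ∈ Finset.range n, (x k i : ℤ) := by
  simp [rowExcess]

/-- The cut `c = 0` sees the whole weight, so this is goodness at `c = 0`. -/
theorem IsGT.antitone_add_gtWeight {n : ℕ} {lam : ℕ → ℕ} {x : ℕ → ℕ → ℕ} (h : IsGT n lam x)
    {mu : Fin n → ℕ} (hgood : IsGood n (extendZero mu) x) : Antitone (mu + gtWeight n x) := by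
  refine antitone_fin_of_succ_le fun j hj => ?_
  have h1 := hgood 0 j hj
  unfold gtDefect at h1
  rw [extendZero_of_lt mu hj, extendZero_of_lt mu (by omega)] at h1
  simp only [rowExcess_zero] at h1
  simp only [Pi.add_apply]
  zify
  rw [h.gtWeight_cast, h.gtWeight_cast]
  simp only
  linarith

/-- The Littlewood–Richardson rule, for the generating function of the patterns. -/
theorem coeff_alternant_mul_gtSum {n : ℕ} (lam : ℕ → ℕ) (mu nu : PartitionSeq n) :
    (alternant (mu.1 + staircase n) * gtSum n lam).coeff
      (Finsupp.equivFunOnFinite.symm (nu.1 + staircase n))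
      = ({x | IsGT n lam x ∧ IsGood n (extendZero mu.1) x ∧ mu.1 + gtWeight n x = nu.1}.ncard : ℤ)
    := by
  classical
  rw [alternant_mul_gtSum_eq_sum_good lam mu.2, MvPolynomial.coeff_sum]
  have h1 : ∀ x ∈ (gtPatterns n lam).filter (IsGood n (extendZero mu.1)),
      (alternant (mu.1 + staircase n + gtWeight n x)).coeff
        (Finsupp.equivFunOnFinite.symm (nu.1 + staircase n))
      = if mu.1 + gtWeight n x = nu.1 then 1 else 0 := by
    intro x hx
    obtain ⟨hx1, hx2⟩ := Finset.mem_filter.1 hx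
    rw [mem_gtPatterns] at hx1
    have h2 := strictAnti_add_staircase ⟨_, hx1.antitone_add_gtWeight hx2⟩
    rw [add_right_comm, coeff_alternant h2 (strictAnti_add_staircase nu)]
    simp only [add_left_inj]
  rw [Finset.sum_congr rfl h1, Finset.sum_boole, Finset.filter_filter]
  have h3 : {x | IsGT n lam x ∧ IsGood n (extendZero mu.1) x ∧ mu.1 + gtWeight n x = nu.1}
      = (((gtPatterns n lam).filter fun x => IsGood n (extendZero mu.1) x ∧
        mu.1 + gtWeight n x = nu.1 : Finset _) : Set (ℕ → ℕ → ℕ)) := by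
    ext x
    simp [mem_gtPatterns]
  rw [h3, Set.ncard_coe_finset]

/-- The linear function which is the defect of `x` for the cut at the entry `x (j + 1) i`. -/
def linDefect (mu : ℕ → ℕ) (x : ℕ → ℕ → ℕ) (j i : ℕ) : ℤ :=
  (mu j : ℤ) - mu (j + 1) + 2 * ∑ l ∈ Finset.range i, (x (j + 1) l : ℤ)
    - ∑ l ∈ Finset.range i, (x j l : ℤ) - ∑ l ∈ Finset.range (i + 1), (x (j + 2) l : ℤ)
    + x (j + 1) i

theorem rowExcess_eq {n : ℕ} {x : ℕ → ℕ → ℕ} {k c t : ℕ} (ht : t ≤ n)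
    (h1 : ∀ i < t, c ≤ x k i) (h2 : ∀ i, t ≤ i → x k i ≤ c) :
    rowExcess n x k c = ∑ i ∈ Finset.range t, (x k i : ℤ) - t * c := by
  obtain ⟨m, rfl⟩ := Nat.exists_eq_add_of_le ht
  unfold rowExcess
  rw [Finset.sum_range_add]
  have e1 : ∑ i ∈ Finset.range m, ((x k (t + i) - c : ℕ) : ℤ) = 0 :=
    Finset.sum_eq_zero fun i _ => by
      have := h2 (t + i) (by omega)
      omega
  have e2 : ∑ i ∈ Finset.range t, ((x k i - c : ℕ) : ℤ)
      = ∑ i ∈ Finset.range t, ((x k i : ℤ) - c) :=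
    Finset.sum_congr rfl fun i hi => by
      have := h1 i (Finset.mem_range.1 hi)
      omega
  rw [e1, e2, Finset.sum_sub_distrib]
  simp

section Good

variable {n : ℕ} {lam mu : ℕ → ℕ} {x : ℕ → ℕ → ℕ}

/-- Interlacing determines which entries lie above the cut `x (j + 1) i`: the first `i` in rows `j`
and `j + 1`, the first `i + 1` in row `j + 2`, up to ties that contribute zero. -/
theorem IsGT.gtDefect_entry (h : IsGT n lam x) {j i : ℕ} (hj : j + 1 < n) (hi : i < n) :
    gtDefect n mu x j (x (j + 1) i) = linDefect mu x j i := by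
  have hanti := h.antitone hj.le
  unfold gtDefect linDefect
  rw [rowExcess_eq (t := i) hi.le (fun l hl => hanti hl.le) (fun l hl => hanti hl),
    rowExcess_eq (t := i) hi.le
      (fun l hl => (hanti (show l + 1 ≤ i by omega)).trans (h.ge j (by omega) l))
      (fun l hl => (h.le j (by omega) l).trans (hanti hl)),
    rowExcess_eq (t := i + 1) hi (fun l hl => (hanti (show l ≤ i by omega)).trans
      (h.le (j + 1) hj l)) (fun l hl => by
        obtain ⟨l, rfl⟩ : ∃ l', l = l' + 1 := ⟨l - 1, by omega⟩
        exact (h.ge (j + 1) hj l).trans (hanti (by omega)))]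
  push_cast
  ring

/-- As a function of `c` the defect is piecewise linear and concave between consecutive entries of
row `j + 1`, so it suffices to test it at these entries. To the right of the largest one, the
antitonicity of `mu` also enters. -/
theorem IsGT.gtDefect_nonneg (h : IsGT n lam x) (hmu : Antitone mu) {j : ℕ} (hj : j + 1 < n)
    (hlin : ∀ i, i < n → 0 ≤ linDefect mu x j i) (c : ℕ) : 0 ≤ gtDefect n mu x j c := by
  classical
  have hanti := h.antitone hj.le
  have hex : ∃ r, x (j + 1) r ≤ c := ⟨j + 1, by rw [h.eq_zero hj.le le_rfl]; exact Nat.zero_le _⟩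
  -- This places `c` between entries `r` and `r - 1` of row `j + 1`. The only possible kinks inside
  -- that interval are at `x (j + 2) r` and `x j (r - 1)`.
  obtain ⟨r, hr, hrmin⟩ : ∃ r, x (j + 1) r ≤ c ∧ ∀ l < r, c < x (j + 1) l :=
    ⟨Nat.find hex, Nat.find_spec hex, fun l hl => not_le.1 (Nat.find_min hex hl)⟩
  have hrj : r ≤ j + 1 := by
    by_contra hlt
    have := hrmin (j + 1) (by omega)
    rw [h.eq_zero hj.le le_rfl] at this
    omega
  have hrn : r < n := by omega
  have hge : ∀ l, r ≤ l → x (j + 1) l ≤ c := fun l hl => (hanti hl).trans hr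
  have e1 := rowExcess_eq (x := x) (k := j + 1) hrn.le (fun l hl => (hrmin l hl).le) hge
  have h2lt : ∀ l < r, c ≤ x (j + 2) l := fun l hl =>
    (hrmin l hl).le.trans (h.le (j + 1) hj l)
  have h2ge : ∀ l, r + 1 ≤ l → x (j + 2) l ≤ c := fun l hl => by
    obtain ⟨l, rfl⟩ : ∃ l', l = l' + 1 := ⟨l - 1, by omega⟩
    exact (h.ge (j + 1) hj l).trans (hge l (by omega))
  have h0lt : ∀ l, l + 1 < r → c ≤ x j l := fun l hl =>
    (hrmin (l + 1) hl).le.trans (h.ge j (by omega) l)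
  have h0ge : ∀ l, r ≤ l → x j l ≤ c := fun l hl => (h.le j (by omega) l).trans (hge l hl)
  have hmuj : mu (j + 1) ≤ mu j := hmu (Nat.le_succ j)
  unfold gtDefect
  rw [e1]
  -- Up to `x (j + 2) r` the comparison is with the left endpoint, entry `r`. Beyond it the
  -- comparison is with the right endpoint, entry `r - 1`, or with `mu` alone if `r = 0`.
  by_cases hc2 : c ≤ x (j + 2) r
  · have e2 := rowExcess_eq (x := x) (k := j + 2) (t := r + 1) hrn (fun l hl => by
      rcases Nat.lt_succ_iff_lt_or_eq.1 hl with h' | rfl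
      · exact h2lt l h'
      · exact hc2) h2ge
    have hg := hlin r hrn
    unfold linDefect at hg
    rw [e2]
    rcases r with _ | r
    · have e0 := rowExcess_eq (x := x) (k := j) (t := 0) (c := c) (Nat.zero_le n)
        (fun l hl => absurd hl (Nat.not_lt_zero l)) h0ge
      rw [e0]
      simp only [Finset.range_zero, Finset.sum_empty] at hg ⊢
      push_cast
      linarith [(Nat.cast_le (α := ℤ)).2 hr]
    · by_cases hc0 : c ≤ x j r
      · have e0 := rowExcess_eq (x := x) (k := j) (t := r + 1) hrn.le (fun l hl => by
          rcases Nat.lt_succ_iff_lt_or_eq.1 hl with h' | rfl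
          · exact h0lt l (by omega)
          · exact hc0) h0ge
        rw [e0]
        push_cast
        linarith [(Nat.cast_le (α := ℤ)).2 hr]
      · have e0 := rowExcess_eq (x := x) (n := n) (k := j) (t := r) (by omega)
          (fun l hl => h0lt l (by omega)) (fun l hl => by
            rcases Nat.eq_or_lt_of_le hl with rfl | h'
            · omega
            · exact h0ge l h')
        have h3 := h.ge j (by omega) r
        rw [e0]
        rw [Finset.sum_range_succ (fun l => (x j l : ℤ)) r] at hg
        push_cast
        linarith [(Nat.cast_le (α := ℤ)).2 h3]
  · have e2 := rowExcess_eq (x := x) (k := j + 2) (t := r) hrn.le h2lt (fun l hl => by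
      rcases Nat.eq_or_lt_of_le hl with rfl | h'
      · omega
      · exact h2ge l h')
    rw [e2]
    rcases r with _ | r
    · have e0 := rowExcess_eq (x := x) (k := j) (t := 0) (c := c) (Nat.zero_le n)
        (fun l hl => absurd hl (Nat.not_lt_zero l)) h0ge
      rw [e0]
      simp only [Finset.range_zero, Finset.sum_empty]
      push_cast
      linarith [(Nat.cast_le (α := ℤ)).2 hmuj]
    · have hg := hlin r (by omega)
      unfold linDefect at hg
      rw [Finset.sum_range_succ (fun l => (x (j + 1) l : ℤ)) r]
      by_cases hc0 : c ≤ x j r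
      · have e0 := rowExcess_eq (x := x) (k := j) (t := r + 1) hrn.le (fun l hl => by
          rcases Nat.lt_succ_iff_lt_or_eq.1 hl with h' | rfl
          · exact h0lt l (by omega)
          · exact hc0) h0ge
        have h3 := h.le j (by omega) r
        rw [e0, Finset.sum_range_succ (fun l => (x j l : ℤ)) r]
        push_cast
        linarith [(Nat.cast_le (α := ℤ)).2 h3]
      · have e0 := rowExcess_eq (x := x) (n := n) (k := j) (t := r) (by omega)
          (fun l hl => h0lt l (by omega)) (fun l hl => by
            rcases Nat.eq_or_lt_of_le hl with rfl | h'
            · omega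
            · exact h0ge l h')
        have h3 := (hrmin r (by omega)).le
        rw [e0]
        push_cast
        linarith [(Nat.cast_le (α := ℤ)).2 h3]

/-- A pattern is good if and only if it satisfies finitely many linear inequalities. -/
theorem IsGT.isGood_iff (h : IsGT n lam x) (hmu : Antitone mu) :
    IsGood n mu x ↔ ∀ j, j + 1 < n → ∀ i, i < n → 0 ≤ linDefect mu x j i :=
  ⟨fun hg j hj i hi => h.gtDefect_entry hj hi ▸ hg (x (j + 1) i) j hj,
    fun hl c j hj => h.gtDefect_nonneg hmu hj (hl j hj) c⟩

/-- In a pattern that is good for `mu = 0`, all the rows are truncations of the top row. -/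
theorem IsGT.eq_top_of_isGood (h : IsGT n lam x) (hg : IsGood n 0 x) (i : ℕ) :
    ∀ k, i < k → k ≤ n → x k i = lam i := by
  induction i using Nat.strong_induction_on with
  | _ i ih =>
  intro k hik hk
  induction hk using Nat.decreasingInduction with
  | self => rw [h.top n le_rfl]
  | of_succ k hkn ihk =>
    have hk1 := ihk (by omega)
    obtain ⟨j, rfl⟩ : ∃ j, k = j + 1 := ⟨k - 1, by omega⟩
    refine le_antisymm (h.le_top hkn.le i) ?_
    -- Once the earlier columns agree with `lam`, their sums cancel in this inequality, leaving `x
    -- (j + 1) i ≥ x (j + 2) i`.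
    have hlin := (h.isGood_iff (mu := 0) antitone_const).1 hg j hkn i (by omega)
    unfold linDefect at hlin
    have s : ∀ k, i ≤ k → k ≤ n → ∑ l ∈ Finset.range i, (x k l : ℤ)
        = ∑ l ∈ Finset.range i, (lam l : ℤ) := fun k hk hkn =>
      Finset.sum_congr rfl fun l hl => by
        have hl' := Finset.mem_range.1 hl
        rw [ih l hl' k (by omega) hkn]
    rw [Finset.sum_range_succ, s _ (by omega) hkn.le, s _ (by omega) (by omega),
      s _ (by omega) hkn, hk1] at hlin
    simp only [Pi.zero_apply] at hlin
    zify
    linarith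

end Good

/-- The pattern whose rows are the truncations of `lam`. -/
def topPattern (lam : ℕ → ℕ) : ℕ → ℕ → ℕ := fun k i => if i < k then lam i else 0

section TopPattern

variable {n : ℕ} {lam : ℕ → ℕ}

theorem isGT_topPattern (hlam : Antitone lam) (h0 : ∀ i, n ≤ i → lam i = 0) :
    IsGT n lam (topPattern lam) := by
  refine ⟨fun i => by simp [topPattern], fun k _ i => ?_, fun k _ i => ?_, fun k hk => ?_⟩
  · simp only [topPattern]
    split_ifs <;> omega
  · have := hlam (Nat.le_succ i)
    simp only [topPattern, Nat.succ_eq_add_one] at this ⊢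
    split_ifs <;> omega
  · funext i
    simp only [topPattern]
    split_ifs with h
    · rfl
    · exact (h0 i (by omega)).symm

theorem sum_topPattern {k : ℕ} (hk : k ≤ n) (f : ℕ → ℤ) (hf : f 0 = 0) :
    ∑ i ∈ Finset.range n, f (topPattern lam k i) = ∑ i ∈ Finset.range k, f (lam i) := by
  obtain ⟨m, rfl⟩ := Nat.exists_eq_add_of_le hk
  rw [Finset.sum_range_add]
  have e1 : ∑ i ∈ Finset.range m, f (topPattern lam k (k + i)) = 0 :=
    Finset.sum_eq_zero fun i _ => by simp [topPattern, hf]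
  rw [e1, add_zero]
  exact Finset.sum_congr rfl fun i hi => by simp [topPattern, Finset.mem_range.1 hi]

theorem isGood_topPattern (hlam : Antitone lam) : IsGood n 0 (topPattern lam) := by
  intro c j hj
  have e : ∀ k ≤ n, rowExcess n (topPattern lam) k c
      = ∑ i ∈ Finset.range k, ((lam i - c : ℕ) : ℤ) := fun k hk =>
    sum_topPattern hk (fun z => ((z - c : ℕ) : ℤ)) (by simp)
  unfold gtDefect
  rw [e _ hj.le, e _ (by omega), e _ (by omega), Finset.sum_range_succ _ (j + 1),
    Finset.sum_range_succ _ j]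
  have := hlam (Nat.le_succ j)
  simp only [Nat.succ_eq_add_one, Pi.zero_apply] at this ⊢
  have h2 : ((lam (j + 1) - c : ℕ) : ℤ) ≤ ((lam j - c : ℕ) : ℤ) := by
    exact_mod_cast Nat.sub_le_sub_right this c
  push_cast
  linarith

end TopPattern

theorem gtWeight_topPattern {n : ℕ} (lam : PartitionSeq n) :
    gtWeight n (topPattern (extendZero lam.1)) = lam.1 := by
  have hx := isGT_topPattern (extendZero_antitone lam.2) fun i hi => extendZero_of_le lam.1 hi
  funext j
  zify
  rw [hx.gtWeight_cast, sum_topPattern (by omega) (fun z => (z : ℤ)) (by simp),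
    sum_topPattern (by omega) (fun z => (z : ℤ)) (by simp), Finset.sum_range_succ,
    add_sub_cancel_left, extendZero_val]

/-- The Schur function is the generating function of Gelfand–Tsetlin patterns. -/
theorem schur_eq_gtSum {n : ℕ} (lam : PartitionSeq n) :
    schur lam = gtSum n (extendZero lam.1) := by
  classical
  refine mul_left_cancel₀ (alternant_staircase_ne_zero n) ?_
  have hx := isGT_topPattern (extendZero_antitone lam.2) fun i hi => extendZero_of_le lam.1 hi
  have hz : extendZero (0 : Fin n → ℕ) = 0 := by
    funext i
    simp [extendZero]
  have h := alternant_mul_gtSum_eq_sum_good (extendZero lam.1) (mu := (0 : Fin n → ℕ))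
    antitone_const
  have hfil : (gtPatterns n (extendZero lam.1)).filter (IsGood n (extendZero (0 : Fin n → ℕ)))
      = {topPattern (extendZero lam.1)} := by
    ext x
    rw [Finset.mem_filter, mem_gtPatterns, Finset.mem_singleton, hz]
    constructor
    · rintro ⟨h1, h2⟩
      funext k i
      by_cases hk : k ≤ n
      · by_cases hi : i < k
        · rw [h1.eq_top_of_isGood h2 i k hi hk]
          simp [topPattern, hi]
        · rw [h1.eq_zero hk (not_lt.1 hi)]
          simp [topPattern, hi]
      · rw [h1.top k (by omega), hx.top k (by omega)]
    · rintro rfl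
      exact ⟨hx, isGood_topPattern (extendZero_antitone lam.2)⟩
  rw [hfil, Finset.sum_singleton, zero_add, gtWeight_topPattern, add_comm (staircase n)] at h
  rw [h, alternant_mul_schur]

/-! ### Positive formulas for the two families of numbers -/

/-- The Littlewood–Richardson rule. -/
theorem lrNumber_eq_ncard {n : ℕ} (lam mu nu : PartitionSeq n) :
    lrNumber lam mu nu = ({x | IsGT n (extendZero lam.1) x ∧ IsGood n (extendZero mu.1) x ∧
      mu.1 + gtWeight n x = nu.1}.ncard : ℤ) := by
  rw [lrNumber_eq_coeff, schur_eq_gtSum, coeff_alternant_mul_gtSum]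

theorem kostkaNumber_eq_ncard {n : ℕ} (lam : PartitionSeq n) (mu : Fin n → ℕ) :
    kostkaNumber lam mu
      = ({x | IsGT n (extendZero lam.1) x ∧ gtWeight n x = mu}.ncard : ℤ) := by
  classical
  rw [kostkaNumber_eq_coeff, schur_eq_gtSum, gtSum, MvPolynomial.coeff_sum]
  simp only [MvPolynomial.coeff_monomial, EmbeddingLike.apply_eq_iff_eq]
  rw [Finset.sum_boole]
  have h3 : {x | IsGT n (extendZero lam.1) x ∧ gtWeight n x = mu}
      = (((gtPatterns n (extendZero lam.1)).filter fun x => gtWeight n x = mu : Finset _) :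
        Set (ℕ → ℕ → ℕ)) := by
    ext x
    simp [mem_gtPatterns]
  rw [h3, Set.ncard_coe_finset]

/-! ### Patterns as solutions of linear systems -/

/-- The pattern with top row `lam` and the lower rows `y`. -/
def gtExtend (n : ℕ) (lam : ℕ → ℕ) (y : Fin n × Fin n → ℕ) : ℕ → ℕ → ℕ := fun k i =>
  if hk : k < n then if hi : i < n then y (⟨k, hk⟩, ⟨i, hi⟩) else 0 else lam i

theorem gtRestrict_gtExtend (n : ℕ) (lam : ℕ → ℕ) (y : Fin n × Fin n → ℕ) :
    gtRestrict n (gtExtend n lam y) = y := by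
  funext p
  simp [gtRestrict, gtExtend]

theorem IsGT.gtExtend_gtRestrict {n : ℕ} {lam : ℕ → ℕ} {x : ℕ → ℕ → ℕ} (h : IsGT n lam x) :
    gtExtend n lam (gtRestrict n x) = x := by
  funext k i
  unfold gtExtend gtRestrict
  split_ifs with hk hi
  · rfl
  · rw [h.eq_zero hk.le (by omega)]
  · rw [h.top k (by omega)]

/-- Only rows below the top are unknowns; the top row is fixed, and under dilation it becomes a
linear form in `N`. -/
theorem ncard_isGT_and (n : ℕ) (lam : ℕ → ℕ) (P : (ℕ → ℕ → ℕ) → Prop) :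
    {x | IsGT n lam x ∧ P x}.ncard
      = {y | IsGT n lam (gtExtend n lam y) ∧ P (gtExtend n lam y)}.ncard := by
  have himg : {y | IsGT n lam (gtExtend n lam y) ∧ P (gtExtend n lam y)}
      = gtRestrict n '' {x | IsGT n lam x ∧ P x} := by
    ext y
    constructor
    · intro hy
      exact ⟨gtExtend n lam y, hy, gtRestrict_gtExtend n lam y⟩
    · rintro ⟨x, ⟨hx, hP⟩, rfl⟩
      simp only [Set.mem_ofPred_eq, hx.gtExtend_gtRestrict]
      exact ⟨hx, hP⟩
  rw [himg, Set.InjOn.ncard_image]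
  exact (gtRestrict_injOn n lam).mono fun x hx => hx.1

theorem isGT_gtExtend_iff {n : ℕ} {lam : ℕ → ℕ} (h0 : ∀ i, n ≤ i → lam i = 0)
    (y : Fin n × Fin n → ℕ) :
    IsGT n lam (gtExtend n lam y) ↔
      (∀ i : Fin n, (gtExtend n lam y 0 i : ℤ) = 0) ∧
      (∀ k i : Fin n, (gtExtend n lam y k i : ℤ) ≤ gtExtend n lam y (k + 1) i) ∧
      ∀ k i : Fin n, (gtExtend n lam y (k + 1) (i + 1) : ℤ) ≤ gtExtend n lam y k i := by
  have hz : ∀ k i, n ≤ i → gtExtend n lam y k i = 0 := by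
    intro k i hi
    unfold gtExtend
    split_ifs with hk hi'
    · omega
    · rfl
    · exact h0 i hi
  constructor
  · intro h
    exact ⟨fun i => by exact_mod_cast h.zero i, fun k i => by exact_mod_cast h.le k k.2 i,
      fun k i => by exact_mod_cast h.ge k k.2 i⟩
  · rintro ⟨h1, h2, h3⟩
    refine ⟨fun i => ?_, fun k hk i => ?_, fun k hk i => ?_, fun k hk => ?_⟩
    · by_cases hi : i < n
      · exact_mod_cast h1 ⟨i, hi⟩
      · exact hz _ _ (by omega)
    · by_cases hi : i < n
      · exact_mod_cast h2 ⟨k, hk⟩ ⟨i, hi⟩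
      · rw [hz k i (by omega)]
        exact Nat.zero_le _
    · by_cases hi : i < n
      · exact_mod_cast h3 ⟨k, hk⟩ ⟨i, hi⟩
      · rw [hz (k + 1) (i + 1) (by omega)]
        exact Nat.zero_le _
    · funext i
      simp [gtExtend, not_lt.2 hk]

theorem extendZero_dilate {n : ℕ} (N : ℕ) (mu : Fin n → ℕ) (i : ℕ) :
    extendZero (fun i => N * mu i) i = N * extendZero mu i := by
  unfold extendZero
  split_ifs <;> simp

section Dilate

variable {n : ℕ} (lam : PartitionSeq n)

/-- The pattern with top row `N lam` and the lower rows `y`. -/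
def dilExtend (N : ℕ) (y : Fin n × Fin n → ℕ) : ℕ → ℕ → ℕ :=
  gtExtend n (extendZero (lam.dilate N).1) y

theorem isHomForm_dilExtend (k i : ℕ) :
    IsHomForm fun N (y : Fin n × Fin n → ℕ) => (dilExtend lam N y k i : ℤ) := by
  unfold dilExtend gtExtend
  by_cases hk : k < n
  · by_cases hi : i < n
    · simpa [hk, hi] using IsHomForm.coord (I := Fin n × Fin n) (⟨k, hk⟩, ⟨i, hi⟩)
    · simpa [hk, hi] using IsHomForm.zero (I := Fin n × Fin n)
  · simp only [hk, dif_neg, not_false_eq_true, PartitionSeq.dilate, extendZero_dilate,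
      Nat.cast_mul]
    exact IsHomForm.natCast_mul _

theorem isHomForm_sum_dilExtend (k m : ℕ) :
    IsHomForm fun N (y : Fin n × Fin n → ℕ) =>
      ∑ i ∈ Finset.range m, (dilExtend lam N y k i : ℤ) :=
  IsHomForm.sum _ fun i _ => isHomForm_dilExtend lam k i

theorem isHomForm_linDefect (mu : Fin n → ℕ) (j i : ℕ) :
    IsHomForm fun N (y : Fin n × Fin n → ℕ) =>
      linDefect (extendZero fun i => N * mu i) (dilExtend lam N y) j i := by
  unfold linDefect
  simp only [extendZero_dilate, Nat.cast_mul, two_mul]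
  exact ((((((IsHomForm.natCast_mul _).sub (IsHomForm.natCast_mul _)).add
    ((isHomForm_sum_dilExtend lam _ _).add (isHomForm_sum_dilExtend lam _ _))).sub
    (isHomForm_sum_dilExtend lam _ _)).sub (isHomForm_sum_dilExtend lam _ _)).add
    (isHomForm_dilExtend lam _ _))

/-- The number of patterns with top row `N lam` which satisfy a homogeneous system of linear
inequalities is backward recursive. -/
theorem backRec_ncard_isGT_and (Q : ℕ → (ℕ → ℕ → ℕ) → Prop)
    (hQ : IsHomCone fun N (y : Fin n × Fin n → ℕ) => Q N (dilExtend lam N y)) :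
    BackRec fun N =>
      (({x | IsGT n (extendZero (lam.dilate N).1) x ∧ Q N x}.ncard : ℕ) : ℚ) := by
  have hGT : IsHomCone fun N (y : Fin n × Fin n → ℕ) =>
      IsGT n (extendZero (lam.dilate N).1) (dilExtend lam N y) := by
    unfold dilExtend
    simp only [isGT_gtExtend_iff fun i hi => extendZero_of_le _ hi]
    exact (IsHomCone.forall fun i => (isHomForm_dilExtend lam _ _).eq IsHomForm.zero).and
      ((IsHomCone.forall fun k => IsHomCone.forall fun i =>
        (isHomForm_dilExtend lam _ _).le (isHomForm_dilExtend lam _ _)).and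
      (IsHomCone.forall fun k => IsHomCone.forall fun i =>
        (isHomForm_dilExtend lam _ _).le (isHomForm_dilExtend lam _ _)))
  refine ((hGT.and hQ).backRec_ncard (∑ i, lam.1 i) fun N y hy p => ?_).congr fun N _ => ?_
  -- Every entry is bounded by the top entry in its column, hence by `N` times the size of `lam`;
  -- this supplies the boundedness needed for elimination.
  · have h1 := hy.1.le_top p.1.2.le p.2
    have h2 : dilExtend lam N y p.1 p.2 = y p := congrFun (gtRestrict_gtExtend n _ y) p
    rw [h2, extendZero_val] at h1
    refine h1.trans (Nat.mul_le_mul_left N ?_)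
    exact Finset.single_le_sum (fun _ _ => Nat.zero_le _) (Finset.mem_univ p.2)
  · rw [ncard_isGT_and]
    rfl

theorem backRec_kostkaNumber (mu : Fin n → ℕ) :
    BackRec fun N => (kostkaNumber (lam.dilate N) (fun i => N * mu i) : ℚ) := by
  refine (backRec_ncard_isGT_and lam (fun N x => ∀ j : Fin n,
    ∑ i ∈ Finset.range n, (x (j + 1) i : ℤ) - ∑ i ∈ Finset.range n, (x j i : ℤ)
      = (N : ℤ) * (mu j : ℤ)) ?_).congr fun N _ => ?_
  · exact IsHomCone.forall fun j => ((isHomForm_sum_dilExtend lam _ _).sub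
      (isHomForm_sum_dilExtend lam _ _)).eq (IsHomForm.natCast_mul _)
  · rw [kostkaNumber_eq_ncard, Int.cast_natCast]
    congr 2
    ext x
    refine and_congr_right fun hx => ?_
    rw [funext_iff]
    refine forall_congr' fun j => ?_
    zify
    rw [hx.gtWeight_cast]

/-- Goodness enters through `IsGT.isGood_iff`: the quantifier over all cuts `c` becomes finitely
many inequalities homogeneous in the pattern and `N`. -/
theorem backRec_lrNumber (mu nu : PartitionSeq n) :
    BackRec fun N => (lrNumber (lam.dilate N) (mu.dilate N) (nu.dilate N) : ℚ) := by
  refine (backRec_ncard_isGT_and lam (fun N x =>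
    (∀ j : Fin n, (j : ℕ) + 1 < n → ∀ i : Fin n,
      0 ≤ linDefect (extendZero fun i => N * mu.1 i) x j i) ∧ ∀ j : Fin n,
    (N : ℤ) * (mu.1 j : ℤ) + (∑ i ∈ Finset.range n, (x (j + 1) i : ℤ)
      - ∑ i ∈ Finset.range n, (x j i : ℤ)) = (N : ℤ) * (nu.1 j : ℤ)) ?_).congr fun N _ => ?_
  · exact (IsHomCone.forall fun j => IsHomCone.imp fun _ => IsHomCone.forall fun i =>
      IsHomForm.zero.le (isHomForm_linDefect lam mu.1 _ _)).and
      (IsHomCone.forall fun j => ((IsHomForm.natCast_mul _).add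
        ((isHomForm_sum_dilExtend lam _ _).sub (isHomForm_sum_dilExtend lam _ _))).eq
        (IsHomForm.natCast_mul _))
  · rw [lrNumber_eq_ncard, Int.cast_natCast]
    congr 2
    ext x
    refine and_congr_right fun hx => ?_
    rw [hx.isGood_iff (extendZero_antitone (mu.dilate N).2), funext_iff]
    refine and_congr ⟨fun h j hj i => h j hj i i.2, fun h j hj i hi =>
      h ⟨j, by omega⟩ hj ⟨i, hi⟩⟩ (forall_congr' fun j => ?_)
    rw [Pi.add_apply]
    zify
    rw [hx.gtWeight_cast]
    simp [PartitionSeq.dilate]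

end Dilate

/-! ### The Gelfand–Tsetlin polytope -/

theorem mem_smul_gtPolytope {n : ℕ} (lam : PartitionSeq n) (mu : Fin n → ℕ) {N : ℕ} (hN : 1 ≤ N)
    (z : GTIndex n → ℝ) : z ∈ (N : ℝ) • gtPolytope lam mu ↔
      z ∈ gtPolytope (lam.dilate N) (fun i => N * mu i) := by
  have hN0 : (0 : ℝ) < N := by exact_mod_cast hN
  rw [Set.mem_smul_set_iff_inv_smul_mem₀ hN0.ne']
  have hinv : (0 : ℝ) < (N : ℝ)⁻¹ := inv_pos.2 hN0
  simp only [gtPolytope, Set.mem_ofPred_eq, Pi.smul_apply, smul_eq_mul, PartitionSeq.dilate,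
    Nat.cast_mul, inv_mul_eq_iff_eq_mul₀ hN0.ne', mul_le_mul_iff_right₀ hinv, ← Finset.mul_sum]

theorem sum_gtIndex_row {n : ℕ} (k : Fin n) (g : ℕ → ℝ) :
    ∑ s : GTIndex n with s.1.1 = k, g s.1.2 = ∑ i ∈ Finset.range (k + 1), g i := by
  refine Finset.sum_bij' (fun s _ => (s.1.2 : ℕ))
    (fun i hi => ⟨(k, ⟨i, by have := Finset.mem_range.1 hi; omega⟩), by
      have := Finset.mem_range.1 hi
      exact Fin.le_def.2 (show i ≤ (k : ℕ) by omega)⟩) ?_ ?_ ?_ ?_ ?_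
  · intro s hs
    have h1 := (Finset.mem_filter.1 hs).2
    have h2 : (s.1.2 : ℕ) ≤ s.1.1 := s.2
    rw [h1] at h2
    exact Finset.mem_range.2 (by omega)
  · intro i _
    simp
  · rintro ⟨⟨k', i⟩, hki⟩ hs
    have h1 : k' = k := (Finset.mem_filter.1 hs).2
    subst h1
    rfl
  · intro i _
    rfl
  · intro s _
    rfl

theorem sum_fin_le {n : ℕ} (k : Fin n) (mu : Fin n → ℕ) :
    ∑ j : Fin n with j ≤ k, (mu j : ℝ) = ∑ i ∈ Finset.range (k + 1), (extendZero mu i : ℝ) := by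
  refine Finset.sum_bij' (fun j _ => (j : ℕ))
    (fun i hi => ⟨i, by have := Finset.mem_range.1 hi; omega⟩) ?_ ?_ ?_ ?_ ?_
  · intro j hj
    have h1 : (j : ℕ) ≤ k := (Finset.mem_filter.1 hj).2
    exact Finset.mem_range.2 (by omega)
  · intro i hi
    have := Finset.mem_range.1 hi
    exact Finset.mem_filter.2 ⟨Finset.mem_univ _, Fin.mk_le_of_le_val (by omega)⟩
  · intro j _
    rfl
  · intro i _
    rfl
  · intro j _
    rw [extendZero_val]

/-- The point of the Gelfand–Tsetlin polytope given by a pattern. -/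
def gtPoint (n : ℕ) (x : ℕ → ℕ → ℕ) : GTIndex n → ℝ := fun s => x (s.1.1 + 1) s.1.2

theorem gtPoint_injOn (n : ℕ) (lam : ℕ → ℕ) : Set.InjOn (gtPoint n) {x | IsGT n lam x} := by
  intro x hx y hy hxy
  funext k i
  by_cases hk : n < k
  · rw [hx.top k hk.le, hy.top k hk.le]
  · by_cases hi : k ≤ i
    · rw [IsGT.eq_zero hx (not_lt.1 hk) hi, IsGT.eq_zero hy (not_lt.1 hk) hi]
    · obtain ⟨k, rfl⟩ : ∃ k', k = k' + 1 := ⟨k - 1, by omega⟩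
      have h := congrFun hxy ⟨(⟨k, by omega⟩, ⟨i, by omega⟩), Fin.mk_le_mk.2 (by omega)⟩
      simp only [gtPoint] at h
      exact_mod_cast h

theorem IsGT.sum_row_eq {n : ℕ} {lam : ℕ → ℕ} {x : ℕ → ℕ → ℕ} (h : IsGT n lam x) {k : ℕ}
    (hk : k ≤ n) : ∑ i ∈ Finset.range n, x k i = ∑ i ∈ Finset.range k, x k i := by
  obtain ⟨m, hm⟩ := Nat.exists_eq_add_of_le hk
  rw [hm, Finset.sum_range_add, add_eq_left]
  exact Finset.sum_eq_zero fun i _ => h.eq_zero hk (by omega)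

/-- The weight records differences of row sums, while the polytope prescribes the row sums
themselves; telescoping translates between the two. -/
theorem IsGT.gtWeight_eq_iff {n : ℕ} {lam : ℕ → ℕ} {x : ℕ → ℕ → ℕ} (h : IsGT n lam x)
    (mu : Fin n → ℕ) : gtWeight n x = mu ↔
      ∀ k : Fin n, ∑ i ∈ Finset.range (k + 1), x (k + 1) i
        = ∑ i ∈ Finset.range (k + 1), extendZero mu i := by
  have hw : ∀ k : Fin n, (gtWeight n x k : ℤ) = ((∑ i ∈ Finset.range (k + 1), x (k + 1) i : ℕ) : ℤ)
      - ((∑ i ∈ Finset.range k, x k i : ℕ) : ℤ) := by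
    intro k
    rw [h.gtWeight_cast, ← h.sum_row_eq k.2, ← h.sum_row_eq k.2.le]
    push_cast
    rfl
  constructor
  · rintro rfl k
    have key : ∀ m ≤ n, ∑ i ∈ Finset.range m, x m i
        = ∑ i ∈ Finset.range m, extendZero (gtWeight n x) i := by
      intro m
      induction m with
      | zero => simp
      | succ m ih =>
        intro hm
        have h1 := hw ⟨m, hm⟩
        have h2 := ih (by omega)
        rw [Finset.sum_range_succ (fun i => extendZero (gtWeight n x) i), ← h2,
          extendZero_of_lt _ hm]
        simp only at h1
        omega
    exact key (k + 1) k.2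
  · intro hk
    funext k
    have h1 := hw k
    have h2 := hk k
    have h3 : ∑ i ∈ Finset.range (k : ℕ), x k i
        = ∑ i ∈ Finset.range (k : ℕ), extendZero mu i := by
      rcases Nat.eq_zero_or_pos (k : ℕ) with h0 | h0
      · rw [h0]
        simp
      · have := hk ⟨k - 1, by omega⟩
        simpa [Nat.sub_add_cancel h0] using this
    rw [Finset.sum_range_succ (fun i => extendZero mu i), extendZero_val] at h2
    omega

/-- The lattice points of the Gelfand–Tsetlin polytope are the patterns of the given weight. -/
theorem image_gtPoint {n : ℕ} (lam : PartitionSeq n) (mu : Fin n → ℕ) :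
    gtPoint n '' {x | IsGT n (extendZero lam.1) x ∧ gtWeight n x = mu}
      = gtPolytope lam mu ∩ {z | ∀ t, ∃ a : ℤ, z t = (a : ℝ)} := by
  have hsum : ∀ x : ℕ → ℕ → ℕ, ∀ k : Fin n, ∑ s : GTIndex n with s.1.1 = k, gtPoint n x s
      = ((∑ i ∈ Finset.range (k + 1), x (k + 1) i : ℕ) : ℝ) := by
    intro x k
    rw [Nat.cast_sum, ← sum_gtIndex_row k fun i => ((x (k + 1) i : ℕ) : ℝ)]
    refine Finset.sum_congr rfl fun s hs => ?_
    rw [← (Finset.mem_filter.1 hs).2]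
    rfl
  ext z
  constructor
  · rintro ⟨x, ⟨hx, hwt⟩, rfl⟩
    refine ⟨⟨fun s hs => ?_, fun s t hst => ⟨fun h => ?_, fun h => ?_⟩, fun k => ?_⟩,
      fun t => ⟨x (t.1.1 + 1) t.1.2, by simp [gtPoint]⟩⟩
    · simp only [gtPoint]
      rw [hs, hx.top n le_rfl, extendZero_val]
    · simp only [gtPoint]
      rw [hst, h]
      exact_mod_cast hx.le _ (by have := t.1.1.2; omega) _
    · simp only [gtPoint]
      rw [hst, h]
      exact_mod_cast hx.ge _ (by have := t.1.1.2; omega) _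
    · rw [hsum, sum_fin_le, (hx.gtWeight_eq_iff mu).1 hwt k]
      push_cast
      rfl
  · rintro ⟨⟨htop, hint, hrow⟩, hZ⟩
    choose Z hZ using hZ
    -- Along the diagonal `(k + 1, i + 1)` entries weakly decrease until the top row `lam ≥ 0`, so
    -- all entries are non-negative.
    have hnonneg : ∀ m : ℕ, ∀ s : GTIndex n, (s.1.1 : ℕ) + 1 + m = n → 0 ≤ z s := by
      intro m
      induction m with
      | zero =>
        intro s hs
        rw [htop s hs]
        positivity
      | succ m ih =>
        intro s hs
        have hs2 : (s.1.2 : ℕ) ≤ s.1.1 := s.2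
        let t : GTIndex n := ⟨(⟨s.1.1 + 1, by omega⟩, ⟨s.1.2 + 1, by omega⟩),
          Fin.mk_le_mk.2 (by omega)⟩
        exact (ih t (by simp only [t]; omega)).trans ((hint s t rfl).2 rfl)
    have hZ0 : ∀ s, 0 ≤ Z s := fun s => by
      have := hnonneg (n - ((s.1.1 : ℕ) + 1)) s (by have := s.1.1.2; omega)
      rw [hZ] at this
      exact_mod_cast this
    -- Row `k` of a pattern is row `k - 1` of the array, because patterns have an additional zero
    -- row at the start.
    let x : ℕ → ℕ → ℕ := fun k i =>
      if h : 0 < k ∧ k < n ∧ i < k then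
        (Z ⟨(⟨k - 1, by omega⟩, ⟨i, by omega⟩), Fin.mk_le_mk.2 (by omega)⟩).toNat
      else if k < n then 0 else extendZero lam.1 i
    have hxz : ∀ k i (hk : k < n) (hi : i ≤ k),
        (x (k + 1) i : ℝ) = z ⟨(⟨k, hk⟩, ⟨i, by omega⟩), Fin.mk_le_mk.2 hi⟩ := by
      intro k i hk hi
      by_cases hkn : k + 1 < n
      · have h : 0 < k + 1 ∧ k + 1 < n ∧ i < k + 1 := ⟨by omega, hkn, by omega⟩
        simp only [x, dif_pos h]
        rw [hZ]
        have := Int.toNat_of_nonneg (hZ0 ⟨(⟨k, hk⟩, ⟨i, by omega⟩), Fin.mk_le_mk.2 hi⟩)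
        exact_mod_cast this
      · have h : ¬(0 < k + 1 ∧ k + 1 < n ∧ i < k + 1) := fun h => hkn h.2.1
        simp only [x, dif_neg h, if_neg hkn]
        rw [htop _ (show k + 1 = n by omega), extendZero_of_lt _ (by omega)]
    have hx0 : ∀ k i, k ≤ n → k ≤ i → x k i = 0 := by
      intro k i hk hi
      have h : ¬(0 < k ∧ k < n ∧ i < k) := fun h => by omega
      simp only [x, dif_neg h]
      split_ifs with hkn
      · rfl
      · exact extendZero_of_le _ (by omega)
    have hGT : IsGT n (extendZero lam.1) x := by
      refine ⟨fun i => hx0 0 i (Nat.zero_le _) (Nat.zero_le _), fun k hk i => ?_, fun k hk i => ?_,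
        fun k hk => ?_⟩
      · by_cases hi : k ≤ i
        · rw [hx0 k i hk.le hi]
          exact Nat.zero_le _
        · obtain ⟨k, rfl⟩ : ∃ k', k = k' + 1 := ⟨k - 1, by omega⟩
          have := (hint ⟨(⟨k, by omega⟩, ⟨i, by omega⟩), Fin.mk_le_mk.2 (by omega)⟩
            ⟨(⟨k + 1, hk⟩, ⟨i, by omega⟩), Fin.mk_le_mk.2 (by omega)⟩ rfl).1 rfl
          rw [← hxz k i (by omega) (by omega), ← hxz (k + 1) i hk (by omega)] at this
          exact_mod_cast this
      · by_cases hi : k ≤ i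
        · rw [hx0 (k + 1) (i + 1) hk (by omega)]
          exact Nat.zero_le _
        · obtain ⟨k, rfl⟩ : ∃ k', k = k' + 1 := ⟨k - 1, by omega⟩
          have := (hint ⟨(⟨k, by omega⟩, ⟨i, by omega⟩), Fin.mk_le_mk.2 (by omega)⟩
            ⟨(⟨k + 1, hk⟩, ⟨i + 1, by omega⟩), Fin.mk_le_mk.2 (by omega)⟩ rfl).2 rfl
          rw [← hxz k i (by omega) (by omega), ← hxz (k + 1) (i + 1) hk (by omega)] at this
          exact_mod_cast this
      · funext i
        have h : ¬(0 < k ∧ k < n ∧ i < k) := fun h => by omega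
        simp only [x, dif_neg h, if_neg (not_lt.2 hk)]
    have hpt : gtPoint n x = z := by
      funext s
      exact hxz s.1.1 s.1.2 s.1.1.2 s.2
    refine ⟨x, ⟨hGT, (hGT.gtWeight_eq_iff mu).2 fun k => ?_⟩, hpt⟩
    have h1 := hrow k
    rw [← hpt, hsum, sum_fin_le] at h1
    exact_mod_cast h1

theorem ehrhartFunction_gtPolytope {n : ℕ} (lam : PartitionSeq n) (mu : Fin n → ℕ) {N : ℕ}
    (hN : 1 ≤ N) : (ehrhartFunction (gtPolytope lam mu) N : ℤ)
      = kostkaNumber (lam.dilate N) fun i => N * mu i := by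
  have h : (N : ℝ) • gtPolytope lam mu = gtPolytope (lam.dilate N) fun i => N * mu i :=
    Set.ext fun z => mem_smul_gtPolytope lam mu hN z
  rw [kostkaNumber_eq_ncard, ehrhartFunction, h, ← image_gtPoint, Set.InjOn.ncard_image]
  exact (gtPoint_injOn n _).mono fun x hx => hx.1

theorem corollary1p9 :
    (∀ (n : ℕ) (lam : PartitionSeq n) (mu : Fin n → ℕ), ∑ i, lam.1 i = ∑ i, mu i →
      ∃ P : Polynomial ℚ, ∀ N : ℕ, 1 ≤ N →
        (kostkaNumber (lam.dilate N) (fun i => N * mu i) : ℚ) = P.eval (N : ℚ) ∧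
        (ehrhartFunction (gtPolytope lam mu) N : ℚ) = P.eval (N : ℚ)) ∧
    (∀ (n : ℕ) (lam mu nu : PartitionSeq n),
      ∃ P : Polynomial ℚ, ∀ N : ℕ, 1 ≤ N →
        (lrNumber (lam.dilate N) (mu.dilate N) (nu.dilate N) : ℚ) = P.eval (N : ℚ)) := by
  refine ⟨fun n lam mu _ => ?_, fun n lam mu nu =>
    exists_polynomial_of_backRec_of_evPoly (backRec_lrNumber lam mu nu)
      (evPoly_lrNumber lam mu nu)⟩
  obtain ⟨P, hP⟩ := exists_polynomial_of_backRec_of_evPoly (backRec_kostkaNumber lam mu)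
    (evPoly_kostkaNumber lam mu)
  refine ⟨P, fun N hN => ⟨hP N hN, ?_⟩⟩
  rw [← hP N hN, ← ehrhartFunction_gtPolytope lam mu hN, Int.cast_natCast]
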